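/- **Theorem 4.** Consider a discrete memoryless half-duplex compound multiple access channel with a relay (all alphabets finite). In a block of $l=n+m$ channel uses the first slot consists of $n$ uses of a channel $p(y_R,y_{11},y_{21}\mid x_{11},x_{21})$ and the second slot of $m$ uses of a channel $p(y_{12},y_{22}\mid x_{12},x_{22},x_R)$. Source $i\in\{1,2\}$ encodes a message $W_i$, uniform on a set of $\lceil 2^{lR_i}\rceil$ elements, the two messages being independent, into $x_{i1}^n(W_i)$ and $x_{i2}^m(W_i)$; the relay sends in the second slot a word $x_R^m$ that is a function of its first-slot reception $y_R^n$; each destination $k\in\{1,2\}$ estimates both messages from $(y_{k1}^n,y_{k2}^m)$. Let $0<\beta<1$ be fixed, with $n=\lfloor\beta l\rfloor$ (so $n=\beta l$ whenever this is an integer). The pair $(R_1,R_2)$ is achievable if there are such codes, one for each $l$, for which the probability that some destination decodes some message wrongly tends to $0$ as $l\to\infty$. Fix any input distribution $p(x_{11})p(x_{21})p(x_{12})p(x_{22})p(x_R)p(\hat y_R\mid y_R)$, with $\hat Y_R$ in a finite alphabet, and for $i,j,k\in\{1,2\}$, $i\ne j$, put (mutual informations in bits) $$a_k(i)=\beta I(X_{i1};X_{j1},Y_{k1},\hat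 Y_R)+(1-\beta)I(X_{i2};X_{j2},X_R,Y_{k2}),$$ $$c_k=\beta I(X_{11},X_{21};Y_{k1},\hat Y_R)+(1-\beta)I(X_{12},X_{22};X_R,Y_{k2}).$$ If $$\max_{k}\ \beta\,[I(Y_R;\hat Y_R)-I(Y_{k1};\hat Y_R)]<\min_{k}\ (1-\beta)\,I(X_R;Y_{k2}),$$ then every pair $(R_1,R_2)$ with $R_i<\min\{a_1(i),a_2(i)\}$ for $i=1,2$ and $R_1+R_2<\min\{c_1,c_2\}$ is achievable, and it is achieved by codes of the following modified compress-and-forward scheme, for suitable constants $0<\epsilon'<\epsilon<1$ and $0\le R_S\le R_U$. The quantization indices $u$ are partitioned into $\lceil 2^{lR_S}\rceil$ bins of equal size $\lceil 2^{l(R_U-R_S)}\rceil$; there are codewords $\hat y_R^n(u)$ for the indices and $x_R^m(s)$ for the bins. The relay picks an index $u$ such that $(y_R^n,\hat y_R^n(u))$ is strongly $\epsilon'$-typical, if there is one (an arbitrary index otherwise), and sends $x_R^m(s)$ for the bin $s$ containing $u$. Destination $k$ decodes sequentially: first the unique $\hat s$ such that $(x_R^m(\hat s),y_{k2}^m)$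 is $\epsilon$-typical; then the unique $\hat u$ in the bin $\hat s$ such that $(\hat y_R^n(\hat u),y_{k1}^n)$ is $\epsilon$-typical; finally the unique pair $(\hat w_1,\hat w_2)$ such that both $(x_{11}^n(\hat w_1),x_{21}^n(\hat w_2),y_{k1}^n,\hat y_R^n(\hat u))$ and $(x_{12}^m(\hat w_1),x_{22}^m(\hat w_2),x_R^m(\hat s),y_{k2}^m)$ are $\epsilon$-typical (a fixed default is taken in any step that has no unique candidate). Here a sequence is strongly $\epsilon$-typical for $p$ if the relative frequency of every symbol $a$ in it differs from $p(a)$ by at most $\epsilon\,p(a)$. -/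

import Mathlib

open Filter Topology

namespace HDcMACr

noncomputable section

/-! ### Finite probability -/

/-- The law of the random variable `A` on a finite sample space `Ω` with mass function `J`. -/
def law {Ω α : Type*} [Fintype Ω] (J : Ω → ℝ) (A : Ω → α) (a : α) : ℝ :=
  open scoped Classical in ∑ ω, if A ω = a then J ω else 0

/-- Mutual information `I(A;B)` in bits. A pair `(a, b)` of probability zero contributes zero. -/
def mutualInfo {Ω α β : Type*} [Fintype Ω] [Fintype α] [Fintype β]
    (J : Ω → ℝ) (A : Ω → α) (B : Ω → β) : ℝ :=
  ∑ a, ∑ b, law J (fun ω => (A ω, B ω)) (a, b) *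
    Real.logb 2 (law J (fun ω => (A ω, B ω)) (a, b) / (law J A a * law J B b))

/-- `x` is strongly `ε`-typical for the mass function `p`: the relative frequency of every symbol
`a` in the sequence `x` differs from `p a` by at most `ε * p a`. -/
def Typical {α : Type*} (p : α → ℝ) (ε : ℝ) {n : ℕ} (x : Fin n → α) : Prop :=
  ∀ a, |(Nat.card {t : Fin n // x t = a} : ℝ) / n - p a| ≤ ε * p a

/-- The unique element satisfying `P` if there is exactly one, and `d` otherwise. -/
def theUnique {α : Type*} (d : α) (P : α → Prop) : α :=
  open scoped Classical in if h : ∃! a, P a then h.choose else d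

/-! ### Channel, input distributions, information quantities

Sources and destinations are indexed by `Fin 2`. `X₁ i`, `X₂ i` are the alphabets of source `i` in
the first and second slot, `Y₁ k`, `Y₂ k` those received by destination `k` in the two slots,
`YR` is received by the relay in the first slot and `XR` is sent by it in the second one. -/

/-- Single-letter transition probabilities `p(y_R, y_11, y_21 | x_11, x_21)` of the first slot and
`p(y_12, y_22 | x_12, x_22, x_R)` of the second slot. -/
structure Channel (X₁ X₂ : Fin 2 → Type*) (XR YR : Type*) (Y₁ Y₂ : Fin 2 → Type*) where
  slot1 : (∀ i, X₁ i) → PMF (YR × ∀ k, Y₁ k)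
  slot2 : (∀ i, X₂ i) → XR → PMF (∀ k, Y₂ k)

/-- The factors of `p(x_11) p(x_21) p(x_12) p(x_22) p(x_R) p(ŷ_R | y_R)`; `Q` is the alphabet of
the quantized relay observation `Ŷ_R`. -/
structure InputDist (X₁ X₂ : Fin 2 → Type*) (XR YR Q : Type*) where
  src1 : ∀ i, PMF (X₁ i)
  src2 : ∀ i, PMF (X₂ i)
  relay : PMF XR
  quant : YR → PMF Q

section

variable {X₁ X₂ : Fin 2 → Type*} {XR YR Q : Type*} {Y₁ Y₂ : Fin 2 → Type*}

/-- Joint mass function of `((X_11, X_21), (Y_R, (Y_11, Y_21)), Ŷ_R)` in the first slot. -/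
def joint1 (W : Channel X₁ X₂ XR YR Y₁ Y₂) (p : InputDist X₁ X₂ XR YR Q) :
    (∀ i, X₁ i) × (YR × ∀ k, Y₁ k) × Q → ℝ := fun ω =>
  (∏ i, (p.src1 i (ω.1 i)).toReal) * (W.slot1 ω.1 ω.2.1).toReal *
    (p.quant ω.2.1.1 ω.2.2).toReal

/-- Joint mass function of `((X_12, X_22), X_R, (Y_12, Y_22))` in the second slot. -/
def joint2 (W : Channel X₁ X₂ XR YR Y₁ Y₂) (p : InputDist X₁ X₂ XR YR Q) :
    (∀ i, X₂ i) × XR × (∀ k, Y₂ k) → ℝ := fun ω =>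
  (∏ i, (p.src2 i (ω.1 i)).toReal) * (p.relay ω.2.1).toReal *
    (W.slot2 ω.1 ω.2.1 ω.2.2).toReal

section

variable [∀ i, Fintype (X₁ i)] [∀ i, Fintype (X₂ i)] [Fintype XR] [Fintype YR] [Fintype Q]
  [∀ k, Fintype (Y₁ k)] [∀ k, Fintype (Y₂ k)]
  (W : Channel X₁ X₂ XR YR Y₁ Y₂) (p : InputDist X₁ X₂ XR YR Q)

/-- `a_k(i) = β I(X_i1; X_j1, Y_k1, Ŷ_R) + (1-β) I(X_i2; X_j2, X_R, Y_k2)`, where `j = 1 - i` is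
the other source. -/
def aBound (β : ℝ) (k i : Fin 2) : ℝ :=
  β * mutualInfo (joint1 W p) (fun ω => ω.1 i) (fun ω => (ω.1 (1 - i), ω.2.1.2 k, ω.2.2)) +
  (1 - β) * mutualInfo (joint2 W p) (fun ω => ω.1 i) (fun ω => (ω.1 (1 - i), ω.2.1, ω.2.2 k))

/-- `c_k = β I(X_11, X_21; Y_k1, Ŷ_R) + (1-β) I(X_12, X_22; X_R, Y_k2)`. -/
def cBound (β : ℝ) (k : Fin 2) : ℝ :=
  β * mutualInfo (joint1 W p) (fun ω => ω.1) (fun ω => (ω.2.1.2 k, ω.2.2)) +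
  (1 - β) * mutualInfo (joint2 W p) (fun ω => ω.1) (fun ω => (ω.2.1, ω.2.2 k))

/-- `I(Y_R; Ŷ_R)`. -/
def infoRelayQuant : ℝ := mutualInfo (joint1 W p) (fun ω => ω.2.1.1) (fun ω => ω.2.2)

/-- `I(Y_k1; Ŷ_R)`. -/
def infoDestQuant (k : Fin 2) : ℝ :=
  mutualInfo (joint1 W p) (fun ω => ω.2.1.2 k) (fun ω => ω.2.2)

/-- `I(X_R; Y_k2)`. -/
def infoRelayDest (k : Fin 2) : ℝ :=
  mutualInfo (joint2 W p) (fun ω => ω.2.1) (fun ω => ω.2.2 k)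

end

/-! ### Block codes and achievability -/

/-- A single-block code with message sets `Fin (M i)` and slots of `n` and `m` channel uses. The
relay maps what it has received in the first slot to its codeword for the second slot. -/
structure Code (X₁ X₂ : Fin 2 → Type*) (XR YR : Type*) (Y₁ Y₂ : Fin 2 → Type*)
    (M : Fin 2 → ℕ) (n m : ℕ) where
  enc1 : ∀ i, Fin (M i) → Fin n → X₁ i
  enc2 : ∀ i, Fin (M i) → Fin m → X₂ i
  relay : (Fin n → YR) → Fin m → XR
  dec : ∀ k, (Fin n → Y₁ k) → (Fin m → Y₂ k) → ∀ i, Fin (M i)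

/-- Probability, for independent uniform messages over the memoryless channel, that at least one
destination decodes at least one of the two messages wrongly. Here `y t` holds all outputs of the
`t`-th use in the first slot and `z t` those of the `t`-th use in the second slot. -/
def Code.errorProb [Fintype YR] [∀ k, Fintype (Y₁ k)] [∀ k, Fintype (Y₂ k)]
    {M : Fin 2 → ℕ} {n m : ℕ} (C : Code X₁ X₂ XR YR Y₁ Y₂ M n m)
    (W : Channel X₁ X₂ XR YR Y₁ Y₂) : ℝ :=
  open scoped Classical in
  (∏ i, (M i : ℝ))⁻¹ * ∑ w : (∀ i, Fin (M i)),
    ∑ y : Fin n → YR × ∀ k, Y₁ k, ∑ z : Fin m → ∀ k, Y₂ k,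
      (∏ t, (W.slot1 (fun i => C.enc1 i (w i) t) (y t)).toReal) *
      (∏ t, (W.slot2 (fun i => C.enc2 i (w i) t) (C.relay (fun s => (y s).1) t) (z t)).toReal) *
      if ∃ k, C.dec k (fun t => (y t).2 k) (fun t => z t k) ≠ w then 1 else 0

/-- The number `2^{lR}`, rounded up to an integer. -/
def size (l : ℕ) (R : ℝ) : ℕ := ⌈(2 : ℝ) ^ ((l : ℝ) * R)⌉₊

instance (l : ℕ) (R : ℝ) : NeZero (size l R) :=
  ⟨(Nat.ceil_pos.2 (Real.rpow_pos_of_pos two_pos _)).ne'⟩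

/-- Length `n` of the first slot in a block of `l` channel uses: `n = β l`, rounded down. -/
def slotLen (β : ℝ) (l : ℕ) : ℕ := ⌊β * l⌋₊

/-- The rate pair `R` is achievable with the slot ratio `β`. -/
def Achievable [Fintype YR] [∀ k, Fintype (Y₁ k)] [∀ k, Fintype (Y₂ k)]
    (W : Channel X₁ X₂ XR YR Y₁ Y₂) (β : ℝ) (R : Fin 2 → ℝ) : Prop :=
  ∃ C : ∀ l : ℕ, Code X₁ X₂ XR YR Y₁ Y₂ (fun i => size l (R i)) (slotLen β l) (l - slotLen β l),
    Tendsto (fun l => (C l).errorProb W) atTop (𝓝 0)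

/-! ### The modified compress-and-forward scheme -/

/-- The codebooks of the scheme. Quantization indices are pairs `u = (s, b)`: the index set is
partitioned into `S` bins of equal size `B`, and `s` is the bin of `u`.
`quantWord u` is the quantization codeword `ŷ_R^n(u)` and `relayWord s` is `x_R^m(s)`.
After the first slot the relay picks an index `pick y` whose quantization codeword is jointly
`ε'`-typical with what it received, whenever there is one. -/
structure CFCode [∀ i, Fintype (X₁ i)] [Fintype YR] [Fintype Q] [∀ k, Fintype (Y₁ k)]
    (W : Channel X₁ X₂ XR YR Y₁ Y₂) (p : InputDist X₁ X₂ XR YR Q) (ε' : ℝ)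
    (M : Fin 2 → ℕ) (S B n m : ℕ) where
  src1 : ∀ i, Fin (M i) → Fin n → X₁ i
  src2 : ∀ i, Fin (M i) → Fin m → X₂ i
  quantWord : Fin S × Fin B → Fin n → Q
  relayWord : Fin S → Fin m → XR
  pick : (Fin n → YR) → Fin S × Fin B
  pick_typical : ∀ y,
    (∃ u, Typical (law (joint1 W p) (fun ω => (ω.2.1.1, ω.2.2))) ε'
      (fun t => (y t, quantWord u t))) →
    Typical (law (joint1 W p) (fun ω => (ω.2.1.1, ω.2.2))) ε'
      (fun t => (y t, quantWord (pick y) t))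

section

variable [∀ i, Fintype (X₁ i)] [∀ i, Fintype (X₂ i)] [Fintype XR] [Fintype YR] [Fintype Q]
  [∀ k, Fintype (Y₁ k)] [∀ k, Fintype (Y₂ k)]
  {W : Channel X₁ X₂ XR YR Y₁ Y₂} {p : InputDist X₁ X₂ XR YR Q} {ε' : ℝ}
  {M : Fin 2 → ℕ} [∀ i, NeZero (M i)] {S B n m : ℕ} [NeZero S] [NeZero B]

/-- First decoding step at destination `k`: the unique bin index `s` such that `x_R^m(s)` is
jointly typical with the second-slot reception. -/
def CFCode.decBin (C : CFCode W p ε' M S B n m) (ε : ℝ) (k : Fin 2) (z : Fin m → Y₂ k) : Fin S :=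
  theUnique 0 fun s =>
    Typical (law (joint2 W p) (fun ω => (ω.2.1, ω.2.2 k))) ε (fun t => (C.relayWord s t, z t))

/-- Second decoding step: the unique quantization index `u` in the bin `s` such that `ŷ_R^n(u)` is
jointly typical with the first-slot reception. -/
def CFCode.decQuant (C : CFCode W p ε' M S B n m) (ε : ℝ) (k : Fin 2) (s : Fin S)
    (y : Fin n → Y₁ k) : Fin S × Fin B :=
  theUnique (s, 0) fun u => u.1 = s ∧
    Typical (law (joint1 W p) (fun ω => (ω.2.1.2 k, ω.2.2))) ε (fun t => (y t, C.quantWord u t))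

/-- Third decoding step: the unique message pair whose codewords are, in both slots, jointly typical
with the receptions, `ŷ_R^n(u)` and `x_R^m(s)`. -/
def CFCode.decMsg (C : CFCode W p ε' M S B n m) (ε : ℝ) (k : Fin 2) (s : Fin S)
    (u : Fin S × Fin B) (y : Fin n → Y₁ k) (z : Fin m → Y₂ k) : ∀ i, Fin (M i) :=
  theUnique (fun _ => 0) fun w =>
    Typical (law (joint1 W p) (fun ω => (ω.1, ω.2.1.2 k, ω.2.2))) ε
      (fun t => ((fun i => C.src1 i (w i) t), y t, C.quantWord u t)) ∧
    Typical (law (joint2 W p) (fun ω => (ω.1, ω.2.1, ω.2.2 k))) ε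
      (fun t => ((fun i => C.src2 i (w i) t), C.relayWord s t, z t))

/-- The block code run by the scheme: the relay sends the codeword of the bin of its quantization
index, and the destinations perform the three decoding steps one after the other. -/
def CFCode.toCode (C : CFCode W p ε' M S B n m) (ε : ℝ) : Code X₁ X₂ XR YR Y₁ Y₂ M n m where
  enc1 := C.src1
  enc2 := C.src2
  relay y := C.relayWord (C.pick y).1
  dec k y z :=
    let s := C.decBin ε k z
    let u := C.decQuant ε k s y
    C.decMsg ε k s u y z

/-- The rate pair `R` is achieved, with the slot ratio `β`, by codes of the modified
compress-and-forward scheme for the input distribution `p`, with `2^{l RS}` bins and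
`2^{l RU}` quantization indices, hence bins of size `2^{l (RU - RS)}`. -/
def AchievableByCF (W : Channel X₁ X₂ XR YR Y₁ Y₂) (p : InputDist X₁ X₂ XR YR Q)
    (β : ℝ) (R : Fin 2 → ℝ) : Prop :=
  ∃ ε' ε RS RU : ℝ, 0 < ε' ∧ ε' < ε ∧ ε < 1 ∧ 0 ≤ RS ∧ RS ≤ RU ∧
    ∃ C : ∀ l : ℕ, CFCode W p ε' (fun i => size l (R i)) (size l RS) (size l (RU - RS))
        (slotLen β l) (l - slotLen β l),
      Tendsto (fun l => ((C l).toCode ε).errorProb W) atTop (𝓝 0)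

end

end

end

end HDcMACr

/-! The proof is a random coding argument. All codebooks are drawn at random with independent
letters, and at first the relay's choice is random too: it selects uniformly among the quantization
indices that are typical with its reception. The averaged error probability is bounded by a sum of
terms that vanish as the block length grows; a codebook and a deterministic choice no worse than the
average are then extracted.

Write `n` and `m` for the slot lengths. Up to corrections proportional to the typicality parameter,
the error events impose these conditions. Covering of the relay's reception (`expect_covering_le`)
needs `RU > β I(Y_R;Ŷ_R)`. Excluding wrong bins (`expect_binTyp_wrong_le`) needs `RS < (1-β)
I(X_R;Y_k2)`, and excluding wrong indices in the right bin (`expect_quantTyp_wrong_le`) needs `RU -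
RS < β I(Y_k1;Ŷ_R)`. The hypothesis comparing the relay link with the quantization rate says exactly
that these three are compatible (`exists_bin_rates`). A wrong message pair has one or two wrong
components (`sum_ne_le`). Given the bin, the packing bounds of the two slots multiply, which
produces `a_k(i)` and `c_k`.

Two points need more than independence. First, the selected quantization word was not generated
together with the other variables of the first slot; it is still jointly typical with the sources
and the destinations, because these depend on it only through `Y_R`. This is the Markov lemma
(`expect_not_typical_markov_le`, `expect_select_not_typical_le`), and the reason for the gap between
`ε'` and `ε`. Second, once an index has been selected, the remaining quantization words are no
longer independent with the original law. Exchangeability shows that this costs at most a factor 2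
(`expect_uniformOn_sum_le`).

Everything is affine in the typicality parameter, so the strict inequalities between informations
survive for small positive values (`achievableByCF_of_info`). -/

namespace HDcMACr

noncomputable section

open scoped Classical

/-! ### Expectations over finite sample spaces -/

/-- Expectation of `f` under the mass function `p`. -/
def expect {Ω : Type*} [Fintype Ω] (p f : Ω → ℝ) : ℝ := ∑ ω, p ω * f ω

/-- `p` is a probability mass function. -/
structure IsMass {Ω : Type*} [Fintype Ω] (p : Ω → ℝ) : Prop where
  nonneg : ∀ ω, 0 ≤ p ω
  sum_eq_one : ∑ ω, p ω = 1

/-- Mass function of independent variables with mass functions `q i`. -/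
def piMass {ι : Type*} [Fintype ι] {α : ι → Type*} (q : ∀ i, α i → ℝ) (x : ∀ i, α i) : ℝ :=
  ∏ i, q i (x i)

/-- Indicator of a proposition. -/
def ind (P : Prop) : ℝ := if P then 1 else 0

lemma ind_of_true {P : Prop} (h : P) : ind P = 1 := if_pos h

lemma ind_of_false {P : Prop} (h : ¬ P) : ind P = 0 := if_neg h

lemma ind_nonneg (P : Prop) : 0 ≤ ind P := by unfold ind; split_ifs <;> norm_num

lemma ind_le_one (P : Prop) : ind P ≤ 1 := by unfold ind; split_ifs <;> norm_num

lemma ind_le_of_imp {P : Prop} {c : ℝ} (hc : 0 ≤ c) (h : P → 1 ≤ c) : ind P ≤ c := by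
  unfold ind; split_ifs with hP
  exacts [h hP, hc]

lemma ind_mono {P P' : Prop} (h : P → P') : ind P ≤ ind P' :=
  ind_le_of_imp (ind_nonneg _) fun hP => (ind_of_true (h hP)).ge

lemma ind_not (P : Prop) : ind (¬ P) = 1 - ind P := by
  by_cases h : P <;> simp [ind, h]

section expect

variable {Ω Ω' α : Type*} [Fintype Ω] [Fintype Ω'] [Fintype α] {p f g : Ω → ℝ}

lemma expect_mono (hp : IsMass p) (h : ∀ ω, f ω ≤ g ω) : expect p f ≤ expect p g :=
  Finset.sum_le_sum fun ω _ => mul_le_mul_of_nonneg_left (h ω) (hp.nonneg ω)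

lemma expect_const (hp : IsMass p) (c : ℝ) : expect p (fun _ => c) = c := by
  rw [expect, ← Finset.sum_mul, hp.sum_eq_one, one_mul]

lemma expect_le_const (hp : IsMass p) {c : ℝ} (h : ∀ ω, f ω ≤ c) : expect p f ≤ c :=
  (expect_mono hp h).trans (expect_const hp c).le

lemma expect_nonneg (hp : IsMass p) (h : ∀ ω, 0 ≤ f ω) : 0 ≤ expect p f :=
  Finset.sum_nonneg fun ω _ => mul_nonneg (hp.nonneg ω) (h ω)

lemma expect_add (p f g : Ω → ℝ) : expect p (fun ω => f ω + g ω) = expect p f + expect p g := by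
  simp only [expect, mul_add, Finset.sum_add_distrib]

lemma expect_sub (p f g : Ω → ℝ) : expect p (fun ω => f ω - g ω) = expect p f - expect p g := by
  simp only [expect, mul_sub, Finset.sum_sub_distrib]

lemma expect_sum {ι : Type*} (s : Finset ι) (p : Ω → ℝ) (f : ι → Ω → ℝ) :
    expect p (fun ω => ∑ i ∈ s, f i ω) = ∑ i ∈ s, expect p (f i) := by
  simp only [expect, Finset.mul_sum]
  exact Finset.sum_comm

lemma expect_mul_left (p f : Ω → ℝ) (c : ℝ) :
    expect p (fun ω => c * f ω) = c * expect p f := by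
  simp only [expect, Finset.mul_sum]
  exact Finset.sum_congr rfl fun _ _ => by ring

lemma expect_mul_right (p f : Ω → ℝ) (c : ℝ) :
    expect p (fun ω => f ω * c) = expect p f * c := by
  simp only [expect, Finset.sum_mul, mul_assoc]

lemma expect_comm (p : Ω → ℝ) (q : Ω' → ℝ) (f : Ω → Ω' → ℝ) :
    expect p (fun a => expect q (fun b => f a b)) =
      expect q (fun b => expect p (fun a => f a b)) := by
  simp only [expect, Finset.mul_sum]
  rw [Finset.sum_comm]
  exact Finset.sum_congr rfl fun _ _ => Finset.sum_congr rfl fun _ _ => by ring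

/-- Positivity of the mass matters as much as the inequality: a choice of positive probability
inherits whatever the random choice satisfies almost surely, here typicality of the relay's pick. -/
lemma exists_le_expect (hp : IsMass p) (f : Ω → ℝ) : ∃ ω, 0 < p ω ∧ f ω ≤ expect p f := by
  by_contra! h
  have h1 : ∃ ω, 0 < p ω := by
    by_contra! h0
    have := hp.sum_eq_one
    rw [Finset.sum_eq_zero fun ω _ => le_antisymm (h0 ω) (hp.nonneg ω)] at this
    exact zero_ne_one this
  obtain ⟨ω₀, h₀⟩ := h1
  have : ∑ ω, p ω * expect p f < ∑ ω, p ω * f ω := by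
    refine Finset.sum_lt_sum (fun ω _ => ?_) ⟨ω₀, Finset.mem_univ _, ?_⟩
    · rcases (hp.nonneg ω).eq_or_lt with h' | h'
      · simp [← h']
      · exact (mul_lt_mul_of_pos_left (h ω h') h').le
    · exact mul_lt_mul_of_pos_left (h ω₀ h₀) h₀
  rw [← Finset.sum_mul, hp.sum_eq_one, one_mul] at this
  exact lt_irrefl _ this

lemma law_eq_expect {γ : Type*} (J : Ω → ℝ) (A : Ω → γ) (c : γ) :
    law J A c = expect J (fun ω => ind (A ω = c)) := by
  simp [law, expect, ind]

lemma expect_law (J : Ω → ℝ) (A : Ω → α) (f : α → ℝ) :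
    expect (law J A) f = expect J (fun ω => f (A ω)) := by
  simp only [expect, law, Finset.sum_mul]
  rw [Finset.sum_comm]
  refine Finset.sum_congr rfl fun ω _ => ?_
  simp [ite_mul]

lemma law_nonneg (hp : IsMass p) {α : Type*} (A : Ω → α) (a : α) : 0 ≤ law p A a :=
  Finset.sum_nonneg fun ω _ => by split_ifs; exacts [hp.nonneg ω, le_rfl]

lemma IsMass.law (hp : IsMass p) (A : Ω → α) : IsMass (law p A) := by
  refine ⟨law_nonneg hp A, ?_⟩
  have := expect_law p A (fun _ => 1)
  rw [expect_const hp] at this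
  simpa [expect] using this

end expect

/-! ### Independent variables: factorization, kernels and resampling. -/

section piMass

variable {ι : Type*} [Fintype ι] [DecidableEq ι] {α β : ι → Type*} [∀ i, Fintype (α i)]
  [∀ i, Fintype (β i)]

lemma expect_piMass_prod (q : ∀ i, α i → ℝ) (g : ∀ i, α i → ℝ) :
    expect (piMass q) (fun x => ∏ i, g i (x i)) = ∏ i, expect (q i) (g i) := by
  simp only [expect, piMass, ← Finset.prod_mul_distrib]
  rw [Finset.prod_univ_sum, Fintype.piFinset_univ]

lemma IsMass.piMass {q : ∀ i, α i → ℝ} (hq : ∀ i, IsMass (q i)) : IsMass (piMass q) := by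
  refine ⟨fun x => Finset.prod_nonneg fun i _ => (hq i).nonneg _, ?_⟩
  have := expect_piMass_prod q (fun _ _ => 1)
  simpa [expect, (hq _).sum_eq_one] using this

lemma expect_piMass_eval {q : ∀ i, α i → ℝ} (hq : ∀ i, IsMass (q i)) (j : ι) (f : α j → ℝ) :
    expect (HDcMACr.piMass q) (fun x => f (x j)) = expect (q j) f := by
  have h := expect_piMass_prod q (Function.update (fun i (_ : α i) => (1 : ℝ)) j f)
  rw [Fintype.prod_eq_single j] at h
  · simp only [Function.update_self] at h
    rw [← h]
    congr 1
    funext x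
    rw [Fintype.prod_eq_single j]
    · simp
    · intro i hi
      simp [Function.update_of_ne hi]
  · intro i hi
    rw [Function.update_of_ne hi]
    exact expect_const (hq i) 1

lemma law_piMass (q : ∀ i, α i → ℝ) (A : ∀ i, α i → β i) :
    law (piMass q) (fun x i => A i (x i)) = piMass (fun i => law (q i) (A i)) := by
  funext y
  rw [law_eq_expect]
  have : ∀ x : ∀ i, α i, ind ((fun i => A i (x i)) = y) = ∏ i, ind (A i (x i) = y i) := by
    intro x
    by_cases h : (fun i => A i (x i)) = y
    · rw [ind_of_true h, Finset.prod_eq_one]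
      intro i _
      exact ind_of_true (congrFun h i)
    · rw [ind_of_false h]
      obtain ⟨i, hi⟩ := not_forall.1 fun h' => h (funext h')
      exact (Finset.prod_eq_zero (Finset.mem_univ i) (ind_of_false hi)).symm
  simp only [this]
  rw [expect_piMass_prod q fun i a => ind (A i a = y i)]
  simp only [piMass, law_eq_expect]

lemma expect_piMass_map (q : ∀ i, α i → ℝ) (A : ∀ i, α i → β i) (f : (∀ i, β i) → ℝ) :
    expect (piMass q) (fun x => f (fun i => A i (x i))) =
      expect (piMass fun i => law (q i) (A i)) f := by
  rw [← law_piMass, expect_law]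

lemma expect_piMass_kernel (p : ∀ i, α i → ℝ) (k : ∀ i, α i → β i → ℝ)
    (f : (∀ i, α i) → (∀ i, β i) → ℝ) :
    expect (piMass p) (fun x => expect (piMass fun i => k i (x i)) (fun y => f x y)) =
      expect (piMass fun i (v : α i × β i) => p i v.1 * k i v.1 v.2)
        (fun v => f (fun i => (v i).1) (fun i => (v i).2)) := by
  let e : ((∀ i, α i) × ∀ i, β i) ≃ ∀ i, α i × β i :=
    { toFun := fun v i => (v.1 i, v.2 i)
      invFun := fun v => (fun i => (v i).1, fun i => (v i).2)
      left_inv := fun _ => rfl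
      right_inv := fun _ => rfl }
  simp only [expect, Finset.mul_sum]
  rw [← e.sum_comp, Fintype.sum_prod_type]
  refine Finset.sum_congr rfl fun x _ => Finset.sum_congr rfl fun y _ => ?_
  simp only [piMass, e, Equiv.coe_fn_mk, Finset.prod_mul_distrib]
  ring

/-- Coordinates are independent, so a randomized map acting on each coordinate with its own seed
preserves the product law as soon as it preserves every factor. All resampling of codewords rests on
this. -/
lemma expect_piMass_mix {q : ∀ i, α i → ℝ} {p : ∀ i, β i → ℝ} {g : ∀ i, α i → β i → α i}
    (h : ∀ i f, expect (q i) (fun a => expect (p i) (fun b => f (g i a b))) = expect (q i) f)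
    (F : (∀ i, α i) → ℝ) :
    expect (piMass q) (fun x => expect (piMass p) (fun y => F (fun i => g i (x i) (y i)))) =
      expect (piMass q) F := by
  rw [expect_piMass_kernel q (fun i _ => p i) (fun x y => F (fun i => g i (x i) (y i))),
    expect_piMass_map (fun i (v : α i × β i) => q i v.1 * p i v.2) (fun i v => g i v.1 v.2) F]
  congr 2
  funext i a
  have := h i (fun c => ind (c = a))
  rw [law_eq_expect, expect, Fintype.sum_prod_type]
  simp only [expect, Finset.mul_sum, ← mul_assoc] at this
  rw [this]
  simp [ind]

/-- Redrawing one coordinate does not change the joint law. This is the form in which independence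
is used below: the redrawn coordinate can be averaged while everything else is held fixed. -/
lemma expect_piMass_update {q : ∀ i, α i → ℝ} (hq : ∀ i, IsMass (q i)) (j : ι)
    (F : (∀ i, α i) → ℝ) :
    expect (piMass q) (fun x => expect (q j) (fun a => F (Function.update x j a))) =
      expect (piMass q) F := by
  rw [← expect_piMass_mix (q := q) (p := q) (g := fun i a b => if i = j then b else a) ?_ F]
  · congr 1
    funext x
    rw [← expect_piMass_eval hq j]
    congr 1
    funext y
    congr 1
    funext i
    by_cases h : i = j
    · subst h; simp
    · simp [h]
  · intro i f
    by_cases h : i = j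
    · simp only [h, if_true]
      rw [expect_const (hq i)]
    · simp only [h, if_false, expect_const (hq i)]

/-- Cross terms vanish after redrawing one of the two coordinates, and each diagonal term is at most
1. This is the variance bound for Chebyshev's inequality. -/
lemma expect_sq_sum_le {q : ∀ i, α i → ℝ} (hq : ∀ i, IsMass (q i)) (g : ∀ i, α i → ℝ)
    (h0 : ∀ i, expect (q i) (g i) = 0) (h1 : ∀ i a, |g i a| ≤ 1) :
    expect (piMass q) (fun x => (∑ i, g i (x i)) ^ 2) ≤ Fintype.card ι := by
  simp only [sq, Finset.sum_mul_sum]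
  rw [expect_sum]
  simp only [expect_sum]
  have : ∀ i j, expect (piMass q) (fun x => g i (x i) * g j (x j)) ≤ if j = i then 1 else 0 := by
    intro i j
    split_ifs with h
    · subst h
      refine expect_le_const (IsMass.piMass hq) fun x => ?_
      rw [← sq, ← sq_abs]
      exact pow_le_one₀ (abs_nonneg _) (h1 _ _)
    · rw [← expect_piMass_update hq j]
      refine expect_le_const (IsMass.piMass hq) fun x => ?_
      simp only [Function.update_self, Function.update_of_ne (Ne.symm h), expect_mul_left, h0,
        mul_zero, le_refl]
  refine (Finset.sum_le_sum fun i _ => Finset.sum_le_sum fun j _ => this i j).trans ?_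
  simp

end piMass

/-! ### Typical sequences -/

section typical

variable {α β γ : Type*} [Fintype α] [Fintype β] [Fintype γ]

lemma card_subtype_eq_sum {n : ℕ} (x : Fin n → γ) (a : γ) :
    (Nat.card {t : Fin n // x t = a} : ℝ) = ∑ t, ind (x t = a) := by
  rw [Nat.card_eq_fintype_card, Fintype.card_subtype]
  simp [ind]

lemma sum_ind_mul {n : ℕ} (x : Fin n → γ) (g : γ → ℝ) :
    ∑ a, (∑ t, ind (x t = a)) * g a = ∑ t, g (x t) := by
  simp only [Finset.sum_mul]
  rw [Finset.sum_comm]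
  simp [ind]

/-- The typical average lemma. -/
lemma Typical.abs_sum_sub_le {p : γ → ℝ} {ε : ℝ} {n : ℕ} {x : Fin n → γ} (hx : Typical p ε x)
    (g : γ → ℝ) :
    |∑ t, g (x t) - n * ∑ a, p a * g a| ≤ n * (ε * ∑ a, p a * |g a|) := by
  rcases n.eq_zero_or_pos with rfl | hn
  · simp
  have hn' : (0 : ℝ) < n := by exact_mod_cast hn
  have h : ∑ t, g (x t) - n * ∑ a, p a * g a
      = ∑ a, n * (((∑ t, ind (x t = a)) / n - p a) * g a) := by
    rw [← sum_ind_mul x g, Finset.mul_sum, ← Finset.sum_sub_distrib]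
    refine Finset.sum_congr rfl fun a _ => ?_
    field_simp
  rw [h]
  refine (Finset.abs_sum_le_sum_abs _ _).trans ?_
  rw [Finset.mul_sum, Finset.mul_sum]
  refine Finset.sum_le_sum fun a _ => ?_
  rw [abs_mul, abs_mul, abs_of_pos hn', ← card_subtype_eq_sum, ← mul_assoc ε]
  exact mul_le_mul_of_nonneg_left (mul_le_mul_of_nonneg_right (hx a) (abs_nonneg _)) hn'.le

/-- The tolerance is relative, so it is zero at a symbol of mass zero, and such a symbol cannot
occur. This keeps all logarithms and quotients below meaningful on typical sequences. -/
lemma Typical.pos {p : γ → ℝ} (hp : ∀ a, 0 ≤ p a) {ε : ℝ} {n : ℕ} {x : Fin n → γ}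
    (hx : Typical p ε x) (t : Fin n) : 0 < p (x t) := by
  refine lt_of_le_of_ne (hp _) fun h => ?_
  have h1 := hx (x t)
  rw [← h, mul_zero, sub_zero] at h1
  have h2 : (Nat.card {s : Fin n // x s = x t} : ℝ) / n = 0 := abs_nonpos_iff.1 h1
  have hn : (n : ℝ) ≠ 0 := by exact_mod_cast (Fin.pos t).ne'
  have h3 : 0 < Nat.card {s : Fin n // x s = x t} := by
    have : Nonempty {s : Fin n // x s = x t} := ⟨⟨t, rfl⟩⟩
    exact Nat.card_pos
  rcases div_eq_zero_iff.1 h2 with h4 | h4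
  · exact h3.ne' (by exact_mod_cast h4)
  · exact hn h4

/-- Counts and masses both add up over the fibres of `h`, and so do the relative tolerances. Hence
marginals of a typical sequence are typical with the same `ε`. -/
lemma Typical.map {Ω : Type*} [Fintype Ω] {J : Ω → ℝ} {C : Ω → γ} {ε : ℝ} {n : ℕ} {x : Fin n → γ}
    (hx : Typical (law J C) ε x) (h : γ → β) :
    Typical (law J (fun ω => h (C ω))) ε (fun t => h (x t)) := by
  intro b
  have hc : ∀ f : γ → ℝ, (∑ a, ind (h a = b) * f a) = ∑ a ∈ {a | h a = b}, f a := by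
    intro f
    simp [ind, Finset.sum_filter]
  have h1 : (Nat.card {t : Fin n // h (x t) = b} : ℝ)
      = ∑ a ∈ {a | h a = b}, (Nat.card {t : Fin n // x t = a} : ℝ) := by
    rw [card_subtype_eq_sum (fun t => h (x t)), ← hc]
    simp only [card_subtype_eq_sum]
    rw [← sum_ind_mul x (fun a => ind (h a = b))]
    exact Finset.sum_congr rfl fun _ _ => mul_comm _ _
  have h2 : law J (fun ω => h (C ω)) b = ∑ a ∈ {a | h a = b}, law J C a := by
    rw [law_eq_expect, ← expect_law J C (fun a => ind (h a = b)), ← hc]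
    exact Finset.sum_congr rfl fun _ _ => mul_comm _ _
  rw [h1, h2, Finset.sum_div, ← Finset.sum_sub_distrib, Finset.mul_sum]
  exact (Finset.abs_sum_le_sum_abs _ _).trans (Finset.sum_le_sum fun a _ => hx a)

/-- A sequence of independent variables whose averaged law is `ε'`-close to `p` is `ε`-typical up
to a probability of order `1 / n`. -/
lemma expect_not_typical_le {Ω : Type*} [Fintype Ω] {n : ℕ} (hn : 0 < n) {q : Fin n → Ω → ℝ}
    (hq : ∀ t, IsMass (q t)) (A : Fin n → Ω → α) {p : α → ℝ} (hp : ∀ a, 0 ≤ p a) {ε' ε : ℝ}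
    (hε : ε' < ε) (hmean : ∀ a, |(∑ t, law (q t) (A t) a) / n - p a| ≤ ε' * p a) :
    expect (piMass q) (fun v => ind (¬ Typical p ε (fun t => A t (v t)))) ≤
      (∑ a, (((ε - ε') * p a) ^ 2)⁻¹) / n := by
  have hn' : (0 : ℝ) < n := by exact_mod_cast hn
  have hδ : 0 < ε - ε' := sub_pos.2 hε
  have key : ∀ a, expect (piMass q) (fun v =>
      ind (ε * p a < |(∑ t, ind (A t (v t) = a)) / n - p a|)) ≤ (((ε - ε') * p a) ^ 2)⁻¹ / n := by
    intro a
    have hm := hmean a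
    have hmass : IsMass (piMass q) := IsMass.piMass hq
    rcases (hp a).eq_or_lt with h0 | h0
    -- Here the term of the bound is `0⁻¹ / n = 0`, so Chebyshev is of no use: the symbol must have
    -- probability exactly zero. The mean condition gives this, its tolerance being zero as well.
    · rw [← h0] at hm ⊢
      simp only [mul_zero, sub_zero, abs_nonpos_iff, div_eq_zero_iff, hn'.ne', or_false] at hm
      have : expect (piMass q) (fun v => ∑ t, ind (A t (v t) = a)) = 0 := by
        rw [expect_sum, ← hm]
        refine Finset.sum_congr rfl fun t _ => ?_
        rw [expect_piMass_eval hq t (fun ω => ind (A t ω = a)), law_eq_expect]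
      simp only [mul_zero, sub_zero]
      refine le_trans (le_trans ?_ this.le) (by positivity)
      refine expect_mono hmass fun v => ?_
      refine ind_le_of_imp (Finset.sum_nonneg fun _ _ => ind_nonneg _) fun h => ?_
      by_contra! hlt
      have hz : ∀ t, ind (A t (v t) = a) = 0 := by
        intro t
        have := (Finset.single_le_sum (fun t _ => ind_nonneg (A t (v t) = a))
          (Finset.mem_univ t)).trans_lt hlt
        unfold ind at this ⊢
        split_ifs at this ⊢ <;> simp_all
      simp [hz] at h
    -- Chebyshev for the centred indicators. The mean frequency uses up `ε' * p a` of the tolerance,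
    -- which leaves a deviation of `(ε - ε') * p a`.
    · set g : Fin n → Ω → ℝ := fun t ω => ind (A t ω = a) - law (q t) (A t) a with hg
      have hg0 : ∀ t, expect (q t) (g t) = 0 := by
        intro t
        rw [hg]
        simp only [expect_sub, expect_const (hq t), ← law_eq_expect, sub_self]
      have hg1 : ∀ t ω, |g t ω| ≤ 1 := by
        intro t ω
        have h1 := ind_nonneg (A t ω = a)
        have h2 := ind_le_one (A t ω = a)
        have h3 := law_nonneg (hq t) (A t) a
        have h4 : law (q t) (A t) a ≤ 1 := by
          rw [law_eq_expect]; exact expect_le_const (hq t) fun _ => ind_le_one _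
        simp only [hg]
        rw [abs_le]; constructor <;> linarith
      have hsq := expect_sq_sum_le hq g hg0 hg1
      have hc : 0 < n * ((ε - ε') * p a) := by positivity
      calc expect (piMass q) (fun v => ind (ε * p a < |(∑ t, ind (A t (v t) = a)) / n - p a|))
          ≤ expect (piMass q) (fun v => ((n * ((ε - ε') * p a)) ^ 2)⁻¹ * (∑ t, g t (v t)) ^ 2) := by
            refine expect_mono hmass fun v => ?_
            refine ind_le_of_imp (by positivity) fun h => ?_
            rw [inv_mul_eq_div, le_div_iff₀ (by positivity), one_mul, sq_le_sq, abs_of_pos hc]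
            have e : ∑ t, g t (v t)
                = n * (((∑ t, ind (A t (v t) = a)) / n - p a) -
                  ((∑ t, law (q t) (A t) a) / n - p a)) := by
              simp only [hg, Finset.sum_sub_distrib]
              field_simp
              ring
            rw [e, abs_mul, abs_of_pos hn']
            refine mul_le_mul_of_nonneg_left ?_ hn'.le
            have := abs_sub_abs_le_abs_sub ((∑ t, ind (A t (v t) = a)) / n - p a)
              ((∑ t, law (q t) (A t) a) / n - p a)
            linarith
        _ ≤ ((n * ((ε - ε') * p a)) ^ 2)⁻¹ * n := by
            rw [expect_mul_left]
            refine mul_le_mul_of_nonneg_left ?_ (by positivity)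
            simpa using hsq
        _ = (((ε - ε') * p a) ^ 2)⁻¹ / n := by field_simp
  rw [Finset.sum_div]
  refine le_trans ?_ (Finset.sum_le_sum fun a _ => key a)
  rw [← expect_sum]
  refine expect_mono (IsMass.piMass hq) fun v => ?_
  refine ind_le_of_imp (Finset.sum_nonneg fun _ _ => ind_nonneg _) fun h => ?_
  obtain ⟨a, ha⟩ := not_forall.1 h
  rw [not_le, card_subtype_eq_sum] at ha
  rw [← ind_of_true ha]
  exact Finset.single_le_sum (f := fun a => ind (ε * p a < |(∑ t, ind (A t (v t) = a)) / n - p a|))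
    (fun _ _ => ind_nonneg _) (Finset.mem_univ a)

/-- Independent draws of `A` are typical for the law of `A` with high probability. -/
lemma expect_not_typical_iid_le {Ω : Type*} [Fintype Ω] {n : ℕ} (hn : 0 < n) {J : Ω → ℝ}
    (hJ : IsMass J) (A : Ω → α) {ε : ℝ} (hε : 0 < ε) :
    expect (piMass fun _ : Fin n => J) (fun v => ind (¬ Typical (law J A) ε (fun t => A (v t)))) ≤
      (∑ a, ((ε * law J A a) ^ 2)⁻¹) / n := by
  have := expect_not_typical_le hn (fun _ => hJ) (fun _ => A) (law_nonneg hJ A) hε (fun a => ?_)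
  · simpa using this
  · have hn' : (n : ℝ) ≠ 0 := by exact_mod_cast hn.ne'
    simp [hn']

end typical

/-! ### Information densities; packing, covering and Markov lemmas. -/

section info

variable {Ω α β γ δ : Type*} [Fintype Ω] [Fintype α] [Fintype β] [Fintype γ] [Fintype δ]
  {J : Ω → ℝ}

lemma law_comp_injective {γ δ : Type*} (J : Ω → ℝ) (C : Ω → γ) {h : γ → δ}
    (hh : Function.Injective h) (c : γ) : law J (fun ω => h (C ω)) (h c) = law J C c := by
  simp [law, hh.eq_iff]

lemma mutualInfo_comm (J : Ω → ℝ) (A : Ω → α) (B : Ω → β) :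
    mutualInfo J A B = mutualInfo J B A := by
  unfold mutualInfo
  rw [Finset.sum_comm]
  refine Finset.sum_congr rfl fun b _ => Finset.sum_congr rfl fun a _ => ?_
  have h := law_comp_injective J (fun ω => (A ω, B ω)) Prod.swap_injective (a, b)
  simp only [Prod.swap_prod_mk] at h
  rw [h, mul_comm (law J A a)]

lemma law_fst_eq_sum (J : Ω → ℝ) (A : Ω → α) (B : Ω → β) (a : α) :
    law J A a = ∑ b, law J (fun ω => (A ω, B ω)) (a, b) := by
  simp only [law, Prod.mk.injEq, ite_and]
  rw [Finset.sum_comm]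
  refine Finset.sum_congr rfl fun ω _ => ?_
  split_ifs <;> simp

lemma law_snd_eq_sum (J : Ω → ℝ) (A : Ω → α) (B : Ω → β) (b : β) :
    law J B b = ∑ a, law J (fun ω => (A ω, B ω)) (a, b) := by
  rw [law_fst_eq_sum J B A b]
  refine Finset.sum_congr rfl fun a _ => ?_
  exact law_comp_injective J (fun ω => (A ω, B ω)) Prod.swap_injective (a, b)

/-- Mean absolute information density, the slope of the error exponents in `ε`. -/
def infoSlope (J : Ω → ℝ) (A : Ω → α) (B : Ω → β) : ℝ :=
  ∑ c : α × β, law J (fun ω => (A ω, B ω)) c *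
    |Real.logb 2 (law J (fun ω => (A ω, B ω)) c / (law J A c.1 * law J B c.2))|

lemma law_le_left (hJ : IsMass J) (A : Ω → α) (B : Ω → β) (c : α × β) :
    law J (fun ω => (A ω, B ω)) c ≤ law J A c.1 := by
  rw [law_fst_eq_sum J A B]
  exact Finset.single_le_sum (f := fun b => law J (fun ω => (A ω, B ω)) (c.1, b))
    (fun _ _ => law_nonneg hJ _ _) (Finset.mem_univ c.2)

lemma law_le_right (hJ : IsMass J) (A : Ω → α) (B : Ω → β) (c : α × β) :
    law J (fun ω => (A ω, B ω)) c ≤ law J B c.2 := by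
  rw [law_snd_eq_sum J A B]
  exact Finset.single_le_sum (f := fun a => law J (fun ω => (A ω, B ω)) (a, c.2))
    (fun _ _ => law_nonneg hJ _ _) (Finset.mem_univ c.1)

/-- For jointly typical `(a, b)`, the conditional probability of `a` given `b` is the product of
the marginal probability and a factor `2 ^ s`, where `s` is close to `n` times the mutual
information. -/
lemma Typical.exists_cond_eq (hJ : IsMass J) {A : Ω → α} {B : Ω → β} {ε : ℝ} {n : ℕ}
    {c : Fin n → α × β} (hc : Typical (law J (fun ω => (A ω, B ω))) ε c) :
    ∃ s : ℝ, |s - n * mutualInfo J A B| ≤ n * (ε * infoSlope J A B) ∧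
      ∏ t, law J (fun ω => (A ω, B ω)) (c t) / law J B (c t).2 =
        (2 : ℝ) ^ s * ∏ t, law J A (c t).1 := by
  set g : α × β → ℝ := fun c =>
    Real.logb 2 (law J (fun ω => (A ω, B ω)) c / (law J A c.1 * law J B c.2)) with hg
  -- The exponent is the accumulated information density, whose mean per letter is the mutual
  -- information; the typical average lemma controls the deviation.
  refine ⟨∑ t, g (c t), ?_, ?_⟩
  · have := hc.abs_sum_sub_le g
    rwa [Fintype.sum_prod_type] at this
  · have h0 := hc.pos (law_nonneg hJ _)
    rw [Real.rpow_sum_of_pos two_pos, ← Finset.prod_mul_distrib]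
    refine Finset.prod_congr rfl fun t _ => ?_
    have h1 := (h0 t).trans_le (law_le_left hJ A B _)
    have h2 := (h0 t).trans_le (law_le_right hJ A B _)
    have h3 := h0 t
    rw [hg]
    simp only
    rw [Real.rpow_logb two_pos (by norm_num) (by positivity)]
    field_simp

/-- The packing bound: an independent codeword is jointly typical with a given sequence with
probability at most `2 ^ (-n (I(A;B) - ε C))`. -/
lemma expect_typical_le (hJ : IsMass J) (A : Ω → α) (B : Ω → β) {ε : ℝ} {n : ℕ} (b : Fin n → β) :
    expect (piMass fun _ : Fin n => law J A)
        (fun a => ind (Typical (law J (fun ω => (A ω, B ω))) ε (fun t => (a t, b t)))) ≤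
      (2 : ℝ) ^ (-(n * (mutualInfo J A B - ε * infoSlope J A B))) := by
  have h1 : ∀ a : Fin n → α, (piMass (fun _ : Fin n => law J A) a) *
      ind (Typical (law J (fun ω => (A ω, B ω))) ε (fun t => (a t, b t))) ≤
      (2 : ℝ) ^ (-(n * (mutualInfo J A B - ε * infoSlope J A B))) *
        ∏ t, law J (fun ω => (A ω, B ω)) (a t, b t) / law J B (b t) := by
    intro a
    have hnn : 0 ≤ ∏ t, law J (fun ω => (A ω, B ω)) (a t, b t) / law J B (b t) :=
      Finset.prod_nonneg fun t _ => div_nonneg (law_nonneg hJ _ _) (law_nonneg hJ _ _)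
    by_cases h : Typical (law J (fun ω => (A ω, B ω))) ε (fun t => (a t, b t))
    · obtain ⟨s, hs, he⟩ := h.exists_cond_eq hJ
      rw [ind_of_true h, mul_one, he, ← mul_assoc, ← Real.rpow_add two_pos]
      refine le_mul_of_one_le_left (Finset.prod_nonneg fun t _ => law_nonneg hJ _ _) ?_
      refine Real.one_le_rpow (by norm_num) ?_
      have := (abs_le.1 hs).1
      linarith
    · rw [ind_of_false h, mul_zero]
      positivity
  refine (Finset.sum_le_sum fun a _ => h1 a).trans ?_
  rw [← Finset.mul_sum]
  refine mul_le_of_le_one_right (by positivity) ?_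
  -- The sum over words factors into letters. Each factor is a total conditional mass: 1, or 0 when
  -- the conditioning symbol has mass zero.
  rw [← Fintype.piFinset_univ, ← Finset.prod_univ_sum (fun _ => Finset.univ)
    (fun t a => law J (fun ω => (A ω, B ω)) (a, b t) / law J B (b t))]
  refine Finset.prod_le_one (fun t _ => Finset.sum_nonneg fun a _ =>
    div_nonneg (law_nonneg hJ _ _) (law_nonneg hJ _ _)) fun t _ => ?_
  rw [← Finset.sum_div, ← law_snd_eq_sum]
  exact div_self_le_one _

/-- The covering bound, relative to the conditional distribution `k` of `B` given `A`. -/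
lemma expect_typical_ge (hJ : IsMass J) (A : Ω → α) (B : Ω → β) {k : α → β → ℝ}
    (hk : ∀ a b, law J (fun ω => (A ω, B ω)) (a, b) = law J A a * k a b)
    {ε : ℝ} {n : ℕ} (a : Fin n → α) :
    (2 : ℝ) ^ (-(n * (mutualInfo J A B + ε * infoSlope J B A))) *
      expect (piMass fun t => k (a t))
        (fun b => ind (Typical (law J (fun ω => (A ω, B ω))) ε (fun t => (a t, b t)))) ≤
    expect (piMass fun _ : Fin n => law J B)
        (fun b => ind (Typical (law J (fun ω => (A ω, B ω))) ε (fun t => (a t, b t)))) := by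
  rw [expect, Finset.mul_sum]
  refine Finset.sum_le_sum fun b _ => ?_
  by_cases h : Typical (law J (fun ω => (A ω, B ω))) ε (fun t => (a t, b t))
  -- The roles of `A` and `B` are exchanged: the conditional law of `B` given `A` is compared with
  -- the marginal of `B`. This is why `infoSlope J B A` appears.
  · have h' : Typical (law J (fun ω => (B ω, A ω))) ε (fun t => (b t, a t)) := h.map Prod.swap
    obtain ⟨s, hs, he⟩ := h'.exists_cond_eq hJ
    have hc : ∏ t, law J (fun ω => (B ω, A ω)) (b t, a t) / law J A (a t) =
        piMass (fun t => k (a t)) b := by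
      refine Finset.prod_congr rfl fun t _ => ?_
      have h3 := law_comp_injective J (fun ω => (A ω, B ω)) Prod.swap_injective (a t, b t)
      simp only [Prod.swap_prod_mk] at h3
      have h1 := (h.pos (law_nonneg hJ _) t).trans_le (law_le_left hJ A B _)
      rw [h3, hk, mul_div_cancel_left₀ _ h1.ne']
    simp only [ind_of_true h, mul_one]
    rw [← hc, he, ← mul_assoc, ← Real.rpow_add two_pos]
    refine mul_le_of_le_one_left (Finset.prod_nonneg fun t _ => law_nonneg hJ _ _) ?_
    refine Real.rpow_le_one_of_one_le_of_nonpos (by norm_num) ?_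
    have := (abs_le.1 hs).2
    rw [mutualInfo_comm J B A] at this
    linarith
  · simp [ind_of_false h]

/-- The Markov lemma: if `A - R - B` is a Markov chain, `(r, b)` is `ε'`-typical, and `A` is drawn
from its conditional distribution given `R = r`, then `(A, b)` is `ε`-typical with high
probability. -/
lemma expect_not_typical_markov_le (hJ : IsMass J) (R : Ω → δ) (A : Ω → α) (B : Ω → β)
    {k : δ → β → ℝ}
    (hk : ∀ a r b, law J (fun ω => (A ω, R ω, B ω)) (a, r, b) =
      law J (fun ω => (A ω, R ω)) (a, r) * k r b)
    {ε' ε : ℝ} (hε : ε' < ε) {n : ℕ} (hn : 0 < n) {r : Fin n → δ} {b : Fin n → β}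
    (hrb : Typical (law J (fun ω => (R ω, B ω))) ε' (fun t => (r t, b t))) :
    expect (piMass fun _ : Fin n => J) (fun v => ind ((fun t => R (v t)) = r) *
        ind (¬ Typical (law J (fun ω => (A ω, B ω))) ε (fun t => (A (v t), b t)))) ≤
      (∑ c, (((ε - ε') * law J (fun ω => (A ω, B ω)) c) ^ 2)⁻¹) / n *
        expect (piMass fun _ : Fin n => J) (fun v => ind ((fun t => R (v t)) = r)) := by
  have hn' : (0 : ℝ) < n := by exact_mod_cast hn
  have hR : ∀ t, 0 < law J R (r t) := fun t =>
    (hrb.pos (law_nonneg hJ _) t).trans_le (law_le_left hJ R B _)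
  -- Conditioning an independent sequence on `R = r` leaves it independent, with the letter at time
  -- `t` distributed as `J` given `R = r t`.
  set q : Fin n → Ω → ℝ := fun t ω => J ω * ind (R ω = r t) / law J R (r t) with hq
  have hqm : ∀ t, IsMass (q t) := by
    intro t
    refine ⟨fun ω => div_nonneg (mul_nonneg (hJ.nonneg _) (ind_nonneg _)) (hR t).le, ?_⟩
    simp only [hq]
    rw [← Finset.sum_div, div_eq_one_iff_eq (hR t).ne', law_eq_expect, expect]
  have hprod : ∀ v : Fin n → Ω, piMass (fun _ : Fin n => J) v * ind ((fun t => R (v t)) = r) =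
      (∏ t, law J R (r t)) * piMass q v := by
    intro v
    have : ind ((fun t => R (v t)) = r) = ∏ t, ind (R (v t) = r t) := by
      by_cases h : (fun t => R (v t)) = r
      · rw [ind_of_true h, Finset.prod_eq_one fun t _ => ind_of_true (congrFun h t)]
      · obtain ⟨t, ht⟩ := not_forall.1 fun h' => h (funext h')
        rw [ind_of_false h, Finset.prod_eq_zero (Finset.mem_univ t) (ind_of_false ht)]
    rw [this, piMass, piMass, ← Finset.prod_mul_distrib, ← Finset.prod_mul_distrib]
    refine Finset.prod_congr rfl fun t _ => ?_
    simp only [hq]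
    rw [mul_div_cancel₀ _ (hR t).ne']
  have e1 : ∀ f : (Fin n → Ω) → ℝ, expect (piMass fun _ : Fin n => J)
      (fun v => ind ((fun t => R (v t)) = r) * f v) =
      (∏ t, law J R (r t)) * expect (piMass q) f := by
    intro f
    rw [expect, expect, Finset.mul_sum]
    refine Finset.sum_congr rfl fun v _ => ?_
    rw [← mul_assoc, hprod, mul_assoc]
  have e2 := e1 (fun _ => 1)
  simp only [mul_one, expect_const (IsMass.piMass hqm)] at e2
  rw [e1, e2, mul_comm]
  refine mul_le_mul_of_nonneg_right ?_ (Finset.prod_nonneg fun t _ => (hR t).le)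
  refine expect_not_typical_le hn hqm (fun t ω => (A ω, b t)) (law_nonneg hJ _) hε ?_
  rintro ⟨a, b₀⟩
  set w : δ → ℝ := fun d => law J (fun ω => (A ω, R ω)) (a, d) / law J R d with hw
  have hw0 : ∀ d, 0 ≤ w d := fun d => div_nonneg (law_nonneg hJ _ _) (law_nonneg hJ _ _)
  -- The expected frequency of `(a, b₀)` is linear in the joint type of `(r, b)`, with coefficients
  -- `P(A = a | R = d)`.
  have hmean : (∑ t, law (q t) (fun ω => (A ω, b t)) (a, b₀)) =
      ∑ d, w d * Nat.card {t : Fin n // (r t, b t) = (d, b₀)} := by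
    have : ∀ d, w d * (Nat.card {t : Fin n // (r t, b t) = (d, b₀)} : ℝ) =
        ∑ t, w d * (ind (r t = d) * ind (b t = b₀)) := by
      intro d
      rw [card_subtype_eq_sum (fun t => (r t, b t)), Finset.mul_sum]
      refine Finset.sum_congr rfl fun t _ => ?_
      simp only [ind, Prod.mk.injEq, ite_and]
      split_ifs <;> simp
    simp only [this]
    rw [Finset.sum_comm]
    refine Finset.sum_congr rfl fun t _ => ?_
    rw [Finset.sum_eq_single (r t) (fun d _ hd => by simp [ind, hd.symm]) (by simp)]
    simp only [law_eq_expect, expect, hq, hw]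
    rw [ind_of_true trivial, one_mul, Finset.sum_div, Finset.sum_mul]
    refine Finset.sum_congr rfl fun ω _ => ?_
    simp only [ind, Prod.mk.injEq, ite_and]
    split_ifs <;> simp
  -- By the Markov property the target probability is the same linear function of the law of `(R,
  -- B)`. The coefficients are nonnegative, so the relative tolerance `ε'` of `(r, b)` passes to the
  -- mean.
  have hmarg : law J (fun ω => (A ω, B ω)) (a, b₀) =
      ∑ d, w d * law J (fun ω => (R ω, B ω)) (d, b₀) := by
    have h1 : law J (fun ω => (A ω, B ω)) (a, b₀) =
        ∑ d, law J (fun ω => (A ω, R ω, B ω)) (a, d, b₀) := by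
      rw [law_fst_eq_sum J (fun ω => (A ω, B ω)) R]
      refine Finset.sum_congr rfl fun d _ => ?_
      have hinj : Function.Injective fun c : α × δ × β => ((c.1, c.2.2), c.2.1) := by
        rintro ⟨_, _, _⟩ ⟨_, _, _⟩ h
        simp only [Prod.mk.injEq] at h ⊢
        tauto
      exact law_comp_injective J (fun ω => (A ω, R ω, B ω)) hinj (a, d, b₀)
    rw [h1]
    refine Finset.sum_congr rfl fun d _ => ?_
    have h2 : law J (fun ω => (R ω, B ω)) (d, b₀) = law J R d * k d b₀ := by
      rw [law_snd_eq_sum J A (fun ω => (R ω, B ω)), law_snd_eq_sum J A R, Finset.sum_mul]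
      exact Finset.sum_congr rfl fun a _ => hk a d b₀
    rw [hk, h2, hw]
    simp only
    -- If `d` has mass zero, then so has `(a, d)`, and both sides vanish.
    rcases (law_nonneg hJ R d).eq_or_lt with h0 | h0
    · have := law_le_right hJ A R (a, d)
      simp only at this
      rw [← h0] at this
      rw [le_antisymm this (law_nonneg hJ _ _)]
      simp
    · field_simp
  rw [hmean, hmarg, Finset.sum_div, ← Finset.sum_sub_distrib, Finset.mul_sum]
  refine (Finset.abs_sum_le_sum_abs _ _).trans (Finset.sum_le_sum fun d _ => ?_)
  rw [mul_div_assoc, ← mul_sub, abs_mul, abs_of_nonneg (hw0 d)]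
  calc w d * _ ≤ w d * (ε' * law J (fun ω => (R ω, B ω)) (d, b₀)) :=
        mul_le_mul_of_nonneg_left (hrb (d, b₀)) (hw0 d)
    _ = _ := by ring

end info

/-! ### Uniform selection among the suitable words of a random codebook -/

section select

variable {U V : Type*} [Fintype U] [Fintype V]

/-- Uniform distribution on the indices `u` for which `τ (q u)` holds (zero if there are none). -/
def uniformOn (τ : V → Prop) (q : U → V) (u : U) : ℝ :=
  ind (τ (q u)) / ∑ v, ind (τ (q v))

/-- Uniform distribution on the indices `u` for which `τ (q u)` holds, or on all indices if there
are none. -/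
def select (τ : V → Prop) (q : U → V) (u : U) : ℝ :=
  if ∃ v, τ (q v) then uniformOn τ q u else (Fintype.card U : ℝ)⁻¹

lemma sum_ind_pos {τ : V → Prop} {q : U → V} {u : U} (h : τ (q u)) : 0 < ∑ v, ind (τ (q v)) := by
  refine lt_of_lt_of_le one_pos ?_
  rw [← ind_of_true h]
  exact Finset.single_le_sum (f := fun v => ind (τ (q v))) (fun _ _ => ind_nonneg _)
    (Finset.mem_univ u)

lemma uniformOn_nonneg (τ : V → Prop) (q : U → V) (u : U) : 0 ≤ uniformOn τ q u :=
  div_nonneg (ind_nonneg _) (Finset.sum_nonneg fun _ _ => ind_nonneg _)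

lemma isMass_select [Nonempty U] (τ : V → Prop) (q : U → V) : IsMass (select τ q) := by
  unfold select
  split_ifs with h
  · obtain ⟨v, hv⟩ := h
    refine ⟨uniformOn_nonneg τ q, ?_⟩
    simp only [uniformOn]
    rw [← Finset.sum_div, div_self (sum_ind_pos hv).ne']
  · refine ⟨fun _ => by positivity, ?_⟩
    simp

lemma of_select_pos {τ : V → Prop} {q : U → V} {u : U} (hu : 0 < select τ q u)
    (h : ∃ v, τ (q v)) : τ (q u) := by
  rw [select, if_pos h] at hu
  by_contra hn
  simp [uniformOn, ind_of_false hn] at hu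

/-- The factor marking that some word is suitable turns the relay's rule into the uniform choice on
suitable words. Failure of covering is accounted for separately. -/
lemma select_mul_ind (τ : V → Prop) (q : U → V) (u : U) :
    select τ q u * ind (∃ v, τ (q v)) = uniformOn τ q u := by
  by_cases h : ∃ v, τ (q v)
  · simp [select, h, ind]
  · have : ¬ τ (q u) := fun h' => h ⟨u, h'⟩
    simp [select, h, ind, uniformOn, this]

variable {P : V → ℝ} [DecidableEq U]

lemma expect_piMass_perm (P : V → ℝ) (σ : Equiv.Perm U) (F : (U → V) → ℝ) :
    expect (piMass fun _ : U => P) (fun q => F (fun u => q (σ u))) =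
      expect (piMass fun _ : U => P) F := by
  unfold expect
  rw [← (Equiv.arrowCongr σ (Equiv.refl V)).sum_comp]
  refine Finset.sum_congr rfl fun q _ => ?_
  congr 1
  · simp only [piMass, Equiv.arrowCongr_apply, Function.comp_apply, Equiv.refl_apply]
    exact Equiv.prod_comp σ.symm (fun u => P (q u))
  · refine congrArg F (funext fun u => ?_)
    simp

/-- By exchangeability of the words the expectation is the same for every index other than `u'`.
These `card U - 1` quantities sum to at most 1. -/
lemma expect_uniformOn_erase_le (hP : IsMass P) (τ : V → Prop) {u u' : U} (huu : u ≠ u') :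
    expect (piMass fun _ : U => P) (fun q =>
      ind (τ (q u)) / ∑ v ∈ Finset.univ.erase u', ind (τ (q v))) ≤
      ((Fintype.card U : ℝ) - 1)⁻¹ := by
  have hsym : ∀ v ∈ Finset.univ.erase u', expect (piMass fun _ : U => P) (fun q =>
      ind (τ (q v)) / ∑ v ∈ Finset.univ.erase u', ind (τ (q v))) =
      expect (piMass fun _ : U => P) (fun q =>
      ind (τ (q u)) / ∑ v ∈ Finset.univ.erase u', ind (τ (q v))) := by
    intro v hv
    have hv' := Finset.ne_of_mem_erase hv
    rw [← expect_piMass_perm P (Equiv.swap u v)]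
    congr 1
    funext q
    dsimp only
    rw [Equiv.swap_apply_right]
    congr 1
    refine Finset.sum_equiv (Equiv.swap u v) (fun i => ?_) fun i _ => rfl
    have : Equiv.swap u v i = u' ↔ i = u' := by
      rw [Equiv.swap_apply_eq_iff, Equiv.swap_apply_of_ne_of_ne huu.symm hv'.symm]
    simp [this]
  have hcard : ((Finset.univ.erase u').card : ℝ) = Fintype.card U - 1 := by
    rw [Finset.card_erase_of_mem (Finset.mem_univ _), Finset.card_univ, Nat.cast_sub]
    · simp
    · exact Fintype.card_pos_iff.2 ⟨u⟩
  have hpos : 0 < ((Finset.univ.erase u').card : ℝ) := by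
    exact_mod_cast Finset.card_pos.2 ⟨u, Finset.mem_erase.2 ⟨huu, Finset.mem_univ _⟩⟩
  rw [← hcard, ← one_div, le_div_iff₀ hpos, mul_comm, ← nsmul_eq_mul, ← Finset.sum_const,
    ← Finset.sum_congr rfl hsym, ← expect_sum]
  refine expect_le_const (IsMass.piMass fun _ => hP) fun q => ?_
  rw [← Finset.sum_div]
  exact div_self_le_one _

/-- The words at indices other than the selected one behave as independent words, up to a factor
of order one. -/
lemma expect_uniformOn_sum_le (hP : IsMass P) (τ : V → Prop) {A : V → ℝ} (hA : ∀ v, 0 ≤ A v)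
    {s : U → Finset U} {d : ℕ} (hs : ∀ u, u ∉ s u) (hd : ∀ u, (s u).card ≤ d) :
    expect (piMass fun _ : U => P) (fun q => ∑ u, uniformOn τ q u * ∑ u' ∈ s u, A (q u')) ≤
      2 * d * expect P A := by
  have hmass : IsMass (piMass fun _ : U => P) := IsMass.piMass fun _ => hP
  have hEA : 0 ≤ expect P A := expect_nonneg hP hA
  -- Dropping `u'` from the denominator can only increase the ratio and makes it independent of the
  -- word at `u'`, which can then be redrawn and averaged.
  have hpair : ∀ u u', u ≠ u' → expect (piMass fun _ : U => P)
      (fun q => uniformOn τ q u * A (q u')) ≤ ((Fintype.card U : ℝ) - 1)⁻¹ * expect P A := by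
    intro u u' huu
    rw [← expect_piMass_update (fun _ => hP) u']
    refine le_trans ?_ (mul_le_mul_of_nonneg_right (expect_uniformOn_erase_le hP τ huu) hEA)
    rw [← expect_mul_right]
    refine expect_mono hmass fun q => ?_
    rw [← expect_mul_left]
    refine expect_mono hP fun a => ?_
    rw [Function.update_self]
    refine mul_le_mul_of_nonneg_right ?_ (hA a)
    rw [uniformOn, Function.update_of_ne huu]
    by_cases h : τ (q u)
    · have hmem : u ∈ Finset.univ.erase u' := Finset.mem_erase.2 ⟨huu, Finset.mem_univ _⟩
      refine div_le_div_of_nonneg_left (ind_nonneg _) ?_ ?_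
      · refine lt_of_lt_of_le one_pos ?_
        rw [← ind_of_true h]
        exact Finset.single_le_sum (f := fun v => ind (τ (q v))) (fun _ _ => ind_nonneg _) hmem
      · rw [← Finset.sum_erase_add _ _ (Finset.mem_univ u')]
        refine le_add_of_le_of_nonneg (le_of_eq ?_) (ind_nonneg _)
        refine Finset.sum_congr rfl fun v hv => ?_
        rw [Function.update_of_ne (Finset.ne_of_mem_erase hv)]
    · simp [ind_of_false h]
  simp only [Finset.mul_sum]
  rw [expect_sum]
  simp only [expect_sum]
  have hrow : ∀ u, ∑ u' ∈ s u, expect (piMass fun _ : U => P)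
      (fun q => uniformOn τ q u * A (q u')) ≤
      d * (2 * (Fintype.card U : ℝ)⁻¹ * expect P A) := by
    intro u
    rcases (s u).eq_empty_or_nonempty with h0 | ⟨v, hv⟩
    · rw [h0, Finset.sum_empty]
      positivity
    -- A nonempty `s u` avoids `u`, so there are at least two indices and `1 / (N - 1) ≤ 2 / N`.
    -- This is the origin of the factor 2.
    have h2 : (2 : ℝ) ≤ Fintype.card U := by
      have : ∃ a b : U, a ≠ b := ⟨u, v, fun h => hs u (h ▸ hv)⟩
      exact_mod_cast Fintype.one_lt_card_iff.2 this
    have hinv : ((Fintype.card U : ℝ) - 1)⁻¹ ≤ 2 * (Fintype.card U : ℝ)⁻¹ := by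
      rw [← div_eq_mul_inv, ← one_div, div_le_div_iff₀ (by linarith) (by linarith)]
      linarith
    calc _ ≤ ∑ u' ∈ s u, ((Fintype.card U : ℝ) - 1)⁻¹ * expect P A :=
          Finset.sum_le_sum fun u' hu' => hpair u u' fun h => hs u (h ▸ hu')
      _ ≤ ∑ u' ∈ s u, 2 * (Fintype.card U : ℝ)⁻¹ * expect P A :=
          Finset.sum_le_sum fun _ _ => mul_le_mul_of_nonneg_right hinv hEA
      _ = (s u).card * (2 * (Fintype.card U : ℝ)⁻¹ * expect P A) := by
          rw [Finset.sum_const, nsmul_eq_mul]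
      _ ≤ _ := mul_le_mul_of_nonneg_right (by exact_mod_cast hd u) (by positivity)
  refine (Finset.sum_le_sum fun u _ => hrow u).trans ?_
  rw [Finset.sum_const, Finset.card_univ, nsmul_eq_mul]
  rcases Nat.eq_zero_or_pos (Fintype.card U) with h0 | h0
  · rw [h0, Nat.cast_zero, zero_mul]
    positivity
  · have : (Fintype.card U : ℝ) ≠ 0 := by exact_mod_cast h0.ne'
    refine le_of_eq ?_
    field_simp

/-- Probability that no word of a random codebook is suitable. -/
lemma expect_forall_not (hP : IsMass P) (τ : V → Prop) :
    expect (piMass fun _ : U => P) (fun q => ind (¬ ∃ u, τ (q u))) =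
      (1 - expect P (fun a => ind (τ a))) ^ Fintype.card U := by
  have h : ∀ q : U → V, ind (¬ ∃ u, τ (q u)) = ∏ u, ind (¬ τ (q u)) := by
    intro q
    by_cases h : ∃ u, τ (q u)
    · obtain ⟨u, hu⟩ := h
      rw [ind_of_false (not_not_intro ⟨u, hu⟩),
        Finset.prod_eq_zero (Finset.mem_univ u) (ind_of_false (not_not_intro hu))]
    · rw [ind_of_true h, Finset.prod_eq_one fun u _ => ind_of_true fun h' => h ⟨u, h'⟩]
  simp only [h]
  rw [expect_piMass_prod (fun _ : U => P) (fun _ a => ind (¬ τ a)), Finset.prod_const,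
    Finset.card_univ]
  simp only [ind_not, expect_sub, expect_const hP]

end select

/-- A substitute for the estimate `(1 - x y) ^ N ≤ 1 - x + exp (-y N)`. -/
lemma one_sub_pow_le {x y z : ℝ} (N : ℕ) (hx : 0 ≤ x) (hx1 : x ≤ 1) (hy : 0 ≤ y) (hz : y * x ≤ z)
    (hz1 : z ≤ 1) : (1 - z) ^ N ≤ 2 * (1 - x) + Real.exp (-(N * y / 2)) := by
  have hz0 : 0 ≤ z := (mul_nonneg hy hx).trans hz
  -- For `x ≤ 1/2` the term `2 * (1 - x)` is already at least 1. Otherwise `z ≥ y / 2`, and the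
  -- exponential takes over.
  rcases le_total x (1 / 2) with h | h
  · have h1 : (1 - z) ^ N ≤ 1 := pow_le_one₀ (by linarith) (by linarith)
    have := Real.exp_pos (-(N * y / 2))
    linarith
  · have h1 : 1 - z ≤ Real.exp (-(y / 2)) := by
      have := Real.add_one_le_exp (-(y / 2))
      nlinarith
    have h2 := pow_le_pow_left₀ (by linarith : 0 ≤ 1 - z) h1 N
    rw [← Real.exp_nat_mul] at h2
    have h3 : (N : ℝ) * -(y / 2) = -(N * y / 2) := by ring
    rw [h3] at h2
    linarith

/-! ### Kernels, product codebooks -/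

section bind

variable {Ω Ω' : Type*} [Fintype Ω] [Fintype Ω']

/-- Joint mass function of a variable with mass function `p` and a second one drawn by `k`. -/
def bind (p : Ω → ℝ) (k : Ω → Ω' → ℝ) (v : Ω × Ω') : ℝ := p v.1 * k v.1 v.2

lemma expect_bind (p : Ω → ℝ) (k : Ω → Ω' → ℝ) (f : Ω × Ω' → ℝ) :
    expect (bind p k) f = expect p (fun a => expect (k a) (fun b => f (a, b))) := by
  simp only [expect, bind, Fintype.sum_prod_type, Finset.mul_sum, mul_assoc]

lemma IsMass.bind {p : Ω → ℝ} {k : Ω → Ω' → ℝ} (hp : IsMass p) (hk : ∀ a, IsMass (k a)) :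
    IsMass (bind p k) := by
  refine ⟨fun v => mul_nonneg (hp.nonneg _) ((hk _).nonneg _), ?_⟩
  have := expect_bind p k (fun _ => 1)
  simp only [expect_const (hk _), expect_const hp] at this
  simpa only [expect, mul_one] using this

lemma isMass_toReal (p : PMF Ω) : IsMass (fun a => (p a).toReal) := by
  refine ⟨fun _ => ENNReal.toReal_nonneg, ?_⟩
  rw [← ENNReal.toReal_sum fun a _ => p.apply_ne_top a, ← tsum_fintype (L := .unconditional _),
    p.tsum_coe, ENNReal.toReal_one]

end bind

/-! ### Random codebooks of the sources. -/

section codebook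

variable {ι : Type*} [Fintype ι] [DecidableEq ι]

lemma expect_piMass_comm {κ : Type*} [Fintype κ] [DecidableEq κ] {α : ι → Type*}
    [∀ i, Fintype (α i)] (q : ∀ i, κ → α i → ℝ) (F : (∀ i, κ → α i) → ℝ) :
    expect (piMass fun i => piMass fun t => q i t) F =
      expect (piMass fun t => piMass fun i => q i t) (fun x => F (fun i t => x t i)) := by
  unfold expect
  rw [← (Equiv.piComm fun (t : κ) (i : ι) => α i).sum_comp]
  refine Finset.sum_congr rfl fun x _ => ?_
  simp only [piMass, Equiv.piComm_apply]
  rw [Finset.prod_comm]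
  rfl

variable {V : ι → Type*} [∀ i, Fintype (V i)] {M : ι → ℕ} {P : ∀ i, V i → ℝ}

/-- Mass function of independent random codebooks, with words drawn by `P i`. -/
def bookMass (M : ι → ℕ) (P : ∀ i, V i → ℝ) : (∀ i, Fin (M i) → V i) → ℝ :=
  piMass fun i => piMass fun _ : Fin (M i) => P i

lemma isMass_bookMass (hP : ∀ i, IsMass (P i)) : IsMass (bookMass M P) :=
  IsMass.piMass fun i => IsMass.piMass fun _ => hP i

lemma expect_bookMass_words (hP : ∀ i, IsMass (P i)) (w : ∀ i, Fin (M i))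
    (f : (∀ i, V i) → ℝ) :
    expect (bookMass M P) (fun c => f (fun i => c i (w i))) = expect (piMass P) f := by
  rw [bookMass, expect_piMass_map _ (fun i (c : Fin (M i) → V i) => c (w i))]
  congr 2
  funext i a
  rw [law_eq_expect, expect_piMass_eval (fun _ => hP i) (w i) (fun b => ind (b = a))]
  simp [expect, ind]

/-- Resampling the words of the messages that differ from the true ones. -/
lemma expect_bookMass_le (hP : ∀ i, IsMass (P i)) (w w' : ∀ i, Fin (M i))
    {G : (∀ i, V i) → (∀ i, V i) → ℝ} {b : ℝ}
    (h : ∀ x x' : ∀ i, V i, expect (piMass P) (fun x'' => G x (fun i => if w' i = w i then x' i else x'' i)) ≤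
      b) :
    expect (bookMass M P) (fun c => G (fun i => c i (w i)) (fun i => c i (w' i))) ≤ b := by
  -- Only the words at `w' i` with `w' i ≠ w i` are redrawn, so the true words are untouched and the
  -- law of the codebooks is unchanged.
  rw [bookMass, ← expect_piMass_mix (p := P)
    (g := fun i c a => if w' i = w i then c else Function.update c (w' i) a)]
  · refine expect_le_const (isMass_bookMass hP) fun c => ?_
    refine le_trans (le_of_eq ?_) (h (fun i => c i (w i)) (fun i => c i (w' i)))
    congr 1
    funext x
    congr 1
    · funext i
      dsimp only
      split_ifs with hi
      · rfl
      · rw [Function.update_of_ne (Ne.symm hi)]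
    · funext i
      dsimp only
      split_ifs with hi
      · rfl
      · rw [Function.update_self]
  · intro i f
    by_cases hi : w' i = w i
    · simp only [hi, if_true, expect_const (hP i)]
    · simp only [hi, if_false]
      exact expect_piMass_update (fun _ => hP i) (w' i) f

end codebook

/-! ### Covering by random words and typicality of the selected word. -/

section words

variable {Ω α β δ : Type*} [Fintype Ω] [Fintype α] [Fintype β] [Fintype δ] {J : Ω → ℝ}

lemma expect_conditional (R : Ω → δ) (B : Ω → β) {k : δ → β → ℝ}
    (hk : ∀ r b, law J (fun ω => (R ω, B ω)) (r, b) = law J R r * k r b) {n : ℕ}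
    (g : (Fin n → δ) → (Fin n → β) → ℝ) :
    expect (piMass fun _ : Fin n => J) (fun v => expect (piMass fun t => k (R (v t)))
      (fun b => g (fun t => R (v t)) b)) =
    expect (piMass fun _ : Fin n => J) (fun v => g (fun t => R (v t)) (fun t => B (v t))) := by
  rw [expect_piMass_map (fun _ : Fin n => J) (fun _ => R)
      (fun r => expect (piMass fun t => k (r t)) (fun b => g r b)),
    expect_piMass_kernel (fun _ : Fin n => law J R) (fun _ => k),
    expect_piMass_map (fun _ : Fin n => J) (fun _ ω => (R ω, B ω))
      (fun v => g (fun t => (v t).1) (fun t => (v t).2))]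
  congr 2
  funext t v
  exact (hk v.1 v.2).symm

/-- Covering: the probability that a random codebook of `card U` words contains no word that is
jointly typical with `R`. -/
lemma expect_covering_le (hJ : IsMass J) (R : Ω → δ) (B : Ω → β) {k : δ → β → ℝ}
    (hk0 : ∀ r, IsMass (k r))
    (hk : ∀ r b, law J (fun ω => (R ω, B ω)) (r, b) = law J R r * k r b)
    {U : Type*} [Fintype U] [DecidableEq U] {ε : ℝ} (hε : 0 < ε) {n : ℕ} (hn : 0 < n) :
    expect (piMass fun _ : Fin n => J) (fun v =>
      expect (piMass fun _ : U => piMass fun _ : Fin n => law J B) (fun q =>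
        ind (¬ ∃ u, Typical (law J (fun ω => (R ω, B ω))) ε (fun t => (R (v t), q u t))))) ≤
    2 * ((∑ c, ((ε * law J (fun ω => (R ω, B ω)) c) ^ 2)⁻¹) / n) +
      Real.exp (-(Fintype.card U *
        (2 : ℝ) ^ (-(n * (mutualInfo J R B + ε * infoSlope J B R))) / 2)) := by
  have hJn : IsMass (piMass fun _ : Fin n => J) := IsMass.piMass fun _ => hJ
  have hB : IsMass (piMass fun _ : Fin n => law J B) := IsMass.piMass fun _ => hJ.law B
  set y : ℝ := (2 : ℝ) ^ (-(n * (mutualInfo J R B + ε * infoSlope J B R))) with hy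
  set x : (Fin n → δ) → ℝ := fun r => expect (piMass fun t => k (r t))
    (fun b => ind (Typical (law J (fun ω => (R ω, B ω))) ε (fun t => (r t, b t)))) with hx
  have hkm : ∀ r : Fin n → δ, IsMass (piMass fun t => k (r t)) := fun r =>
    IsMass.piMass fun _ => hk0 _
  -- Given the observation, the words are independent and each is suitable with probability at least
  -- `y * x`, where `x` is the probability that a word drawn from the conditional law is typical.
  have hstep : ∀ v : Fin n → Ω,
      expect (piMass fun _ : U => piMass fun _ : Fin n => law J B) (fun q =>
        ind (¬ ∃ u, Typical (law J (fun ω => (R ω, B ω))) ε (fun t => (R (v t), q u t)))) ≤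
      2 * (1 - x (fun t => R (v t))) + Real.exp (-(Fintype.card U * y / 2)) := by
    intro v
    rw [expect_forall_not hB (fun b => Typical (law J (fun ω => (R ω, B ω))) ε
      (fun t => (R (v t), b t)))]
    refine one_sub_pow_le _ (expect_nonneg (hkm _) fun _ => ind_nonneg _)
      (expect_le_const (hkm _) fun _ => ind_le_one _) (by positivity)
      (expect_typical_ge hJ R B hk _) (expect_le_const hB fun _ => ind_le_one _)
  refine (expect_mono hJn hstep).trans ?_
  rw [expect_add, expect_const hJn, expect_mul_left]
  refine add_le_add (mul_le_mul_of_nonneg_left ?_ zero_le_two) le_rfl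
  refine le_trans (le_of_eq ?_) (expect_not_typical_iid_le hn hJ (fun ω => (R ω, B ω)) hε)
  rw [← expect_conditional R B hk (fun r b => ind (¬ Typical (law J (fun ω => (R ω, B ω))) ε
    (fun t => (r t, b t))))]
  congr 1
  funext v
  simp only [ind_not, expect_sub, expect_const (hkm _), hx]

/-- The selected word is jointly typical with everything that depends on the words only through
the observation `R`. -/
lemma expect_select_not_typical_le (hJ : IsMass J) (R : Ω → δ) (A : Ω → α) (B : Ω → β)
    {k : δ → β → ℝ}
    (hk : ∀ a r b, law J (fun ω => (A ω, R ω, B ω)) (a, r, b) =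
      law J (fun ω => (A ω, R ω)) (a, r) * k r b)
    {ε' ε : ℝ} (hε : ε' < ε) {n : ℕ} (hn : 0 < n) {U : Type*} [Fintype U] (q : U → Fin n → β) :
    expect (piMass fun _ : Fin n => J) (fun v => ∑ u, uniformOn
        (fun b : Fin n → β => Typical (law J (fun ω => (R ω, B ω))) ε' (fun t => (R (v t), b t)))
        q u * ind (¬ Typical (law J (fun ω => (A ω, B ω))) ε (fun t => (A (v t), q u t)))) ≤
      (∑ c, (((ε - ε') * law J (fun ω => (A ω, B ω)) c) ^ 2)⁻¹) / n := by
  have hJn : IsMass (piMass fun _ : Fin n => J) := IsMass.piMass fun _ => hJ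
  set K : ℝ := (∑ c, (((ε - ε') * law J (fun ω => (A ω, B ω)) c) ^ 2)⁻¹) / n with hK
  have hK0 : 0 ≤ K := div_nonneg (Finset.sum_nonneg fun _ _ => by positivity) (Nat.cast_nonneg n)
  set τ : (Fin n → δ) → (Fin n → β) → Prop := fun r b =>
    Typical (law J (fun ω => (R ω, B ω))) ε' (fun t => (r t, b t)) with hτ
  -- Splitting by the value `r` of the observation makes the selection weights constants, so the
  -- Markov lemma applies to each `r` and each index. A nonzero weight supplies the typicality which
  -- that lemma assumes.
  have hsplit : ∀ v : Fin n → Ω, ∑ u, uniformOn (τ fun t => R (v t)) q u *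
      ind (¬ Typical (law J (fun ω => (A ω, B ω))) ε (fun t => (A (v t), q u t))) =
      ∑ r, ∑ u, uniformOn (τ r) q u * (ind ((fun t => R (v t)) = r) *
      ind (¬ Typical (law J (fun ω => (A ω, B ω))) ε (fun t => (A (v t), q u t)))) := by
    intro v
    rw [Finset.sum_eq_single (fun t => R (v t)) (fun r _ hr => by simp [ind, hr.symm]) (by simp)]
    simp [ind]
  simp only [hτ] at hsplit
  simp only [hsplit]
  rw [expect_sum]
  simp only [expect_sum, expect_mul_left]
  have hone : ∑ r : Fin n → δ, expect (piMass fun _ : Fin n => J)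
      (fun v => ind ((fun t => R (v t)) = r)) = 1 := by
    rw [← expect_sum]
    refine Eq.trans ?_ (expect_const hJn 1)
    congr 1
    funext v
    rw [Finset.sum_eq_single (fun t => R (v t)) (fun r _ hr => ind_of_false hr.symm) (by simp)]
    exact ind_of_true rfl
  calc
    _ ≤ ∑ r : Fin n → δ, K * expect (piMass fun _ : Fin n => J)
          (fun v => ind ((fun t => R (v t)) = r)) := by
        refine Finset.sum_le_sum fun r _ => ?_
        have hc : 0 ≤ K * expect (piMass fun _ : Fin n => J)
            (fun v => ind ((fun t => R (v t)) = r)) :=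
          mul_nonneg hK0 (expect_nonneg hJn fun _ => ind_nonneg _)
        calc
          _ ≤ ∑ u, uniformOn (τ r) q u * (K * expect (piMass fun _ : Fin n => J)
                (fun v => ind ((fun t => R (v t)) = r))) := by
              refine Finset.sum_le_sum fun u _ => ?_
              by_cases h : τ r (q u)
              · exact mul_le_mul_of_nonneg_left
                  (expect_not_typical_markov_le hJ R A B hk hε hn h) (uniformOn_nonneg _ _ _)
              · have h0 : uniformOn (τ r) q u = 0 := by simp [uniformOn, ind_of_false h]
                simp only [hτ] at h0 ⊢
                rw [h0, zero_mul, zero_mul]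
          _ ≤ _ := by
              rw [← Finset.sum_mul]
              refine mul_le_of_le_one_left hc ?_
              simp only [uniformOn]
              rw [← Finset.sum_div]
              exact div_self_le_one _
    _ = K := by rw [← Finset.mul_sum, hone, mul_one]

end words

/-! ### Packing bounds for one or two wrong source words. -/

section sources

variable {Ω β : Type*} [Fintype Ω] [Fintype β] {J : Ω → ℝ} {X : Fin 2 → Type*}
  [∀ i, Fintype (X i)] {P : ∀ i, X i → ℝ}

lemma law_apply_eq (hP : ∀ i, IsMass (P i)) {A : Ω → ∀ i, X i} (hA : law J A = piMass P)
    (i : Fin 2) : law J (fun ω => A ω i) = P i := by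
  funext a
  rw [law_eq_expect, ← expect_law J A (fun x => ind (x i = a)), hA,
    expect_piMass_eval hP i (fun b => ind (b = a))]
  simp [expect, ind]

/-- The word of the other source is held fixed, so it counts as part of the observation; regrouping
the letters reduces the claim to packing for source `i` alone. -/
lemma expect_source_typical_le (hJ : IsMass J) (hP : ∀ i, IsMass (P i)) {A : Ω → ∀ i, X i}
    (hA : law J A = piMass P) (B : Ω → β) {ε : ℝ} {n : ℕ} (i : Fin 2) (x' : ∀ i, Fin n → X i)
    (b : Fin n → β) :
    expect (piMass fun i => piMass fun _ : Fin n => P i) (fun x =>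
      ind (Typical (law J (fun ω => (A ω, B ω))) ε
        (fun t => (fun j => (if j ≠ i then x' j else x j) t, b t)))) ≤
    (2 : ℝ) ^ (-(n * (mutualInfo J (fun ω => A ω i) (fun ω => (A ω (1 - i), B ω)) -
      ε * infoSlope J (fun ω => A ω i) (fun ω => (A ω (1 - i), B ω))))) := by
  refine le_trans ?_ (expect_typical_le hJ (fun ω => A ω i) (fun ω => (A ω (1 - i), B ω))
    (ε := ε) (n := n) (fun t => (x' (1 - i) t, b t)))
  have hi : 1 - i ≠ i := by fin_cases i <;> decide
  rw [law_apply_eq hP hA i, ← expect_piMass_eval (fun i => IsMass.piMass fun _ : Fin n => hP i) i]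
  refine expect_mono (IsMass.piMass fun i => IsMass.piMass fun _ => hP i) fun x => ?_
  refine ind_mono fun h => ?_
  have := h.map (fun c => (c.1 i, (c.1 (1 - i), c.2)))
  simpa [hi] using this

/-- When both words are fresh, their letter pairs are independent over time, and the pair acts as a
single word over the product alphabet. -/
lemma expect_sources_typical_le (hJ : IsMass J) {A : Ω → ∀ i, X i}
    (hA : law J A = piMass P) (B : Ω → β) {ε : ℝ} {n : ℕ} (b : Fin n → β) :
    expect (piMass fun i => piMass fun _ : Fin n => P i) (fun x =>
      ind (Typical (law J (fun ω => (A ω, B ω))) ε (fun t => (fun j => x j t, b t)))) ≤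
    (2 : ℝ) ^ (-(n * (mutualInfo J A B - ε * infoSlope J A B))) := by
  rw [expect_piMass_comm (fun i (_ : Fin n) => P i), ← hA]
  exact expect_typical_le hJ A B b

end sources

/-! ### The random coding ensemble -/

section

variable {X₁ X₂ : Fin 2 → Type*} {XR YR Q : Type*} {Y₁ Y₂ : Fin 2 → Type*}
  [∀ i, Fintype (X₁ i)] [∀ i, Fintype (X₂ i)] [Fintype XR] [Fintype YR] [Fintype Q]
  [∀ k, Fintype (Y₁ k)] [∀ k, Fintype (Y₂ k)]
  (W : Channel X₁ X₂ XR YR Y₁ Y₂) (p : InputDist X₁ X₂ XR YR Q)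

/-- Mass function of source `i` in the first slot. -/
def src1Mass (i : Fin 2) (a : X₁ i) : ℝ := (p.src1 i a).toReal

/-- Mass function of source `i` in the second slot. -/
def src2Mass (i : Fin 2) (a : X₂ i) : ℝ := (p.src2 i a).toReal

/-- Mass function of the relay input. -/
def relayMass (a : XR) : ℝ := (p.relay a).toReal

/-- Transition mass function of the quantizer. -/
def quantMass (r : YR) (b : Q) : ℝ := (p.quant r b).toReal

/-- Transition mass function of the first slot. -/
def slot1Mass (x : ∀ i, X₁ i) (y : YR × ∀ k, Y₁ k) : ℝ := (W.slot1 x y).toReal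

/-- Transition mass function of the second slot. -/
def slot2Mass (x : ∀ i, X₂ i) (b : XR) (z : ∀ k, Y₂ k) : ℝ := (W.slot2 x b z).toReal

lemma isMass_src1 (i : Fin 2) : IsMass (src1Mass p i) := isMass_toReal _

lemma isMass_src2 (i : Fin 2) : IsMass (src2Mass p i) := isMass_toReal _

lemma isMass_relay : IsMass (relayMass p) := isMass_toReal _

lemma isMass_quant (r : YR) : IsMass (quantMass p r) := isMass_toReal _

lemma isMass_slot1 (x : ∀ i, X₁ i) : IsMass (slot1Mass W x) := isMass_toReal _

lemma isMass_slot2 (x : ∀ i, X₂ i) (b : XR) : IsMass (slot2Mass W x b) := isMass_toReal _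

lemma joint1_eq_bind : joint1 W p = bind (piMass (src1Mass p))
    (fun x => bind (slot1Mass W x) (fun y => quantMass p y.1)) := by
  funext ω
  simp only [joint1, bind, piMass, mul_assoc]
  rfl

lemma joint2_eq_bind : joint2 W p = bind (piMass (src2Mass p))
    (fun x => bind (relayMass p) (fun b => slot2Mass W x b)) := by
  funext ω
  simp only [joint2, bind, piMass, mul_assoc]
  rfl

lemma isMass_joint1 : IsMass (joint1 W p) := by
  rw [joint1_eq_bind]
  exact (IsMass.piMass (isMass_src1 p)).bind fun x => (isMass_slot1 W x).bind fun y =>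
    isMass_quant p y.1

lemma isMass_joint2 : IsMass (joint2 W p) := by
  rw [joint2_eq_bind]
  exact (IsMass.piMass (isMass_src2 p)).bind fun x => (isMass_relay p).bind fun b =>
    isMass_slot2 W x b

lemma expect_ind_eq {Ω : Type*} [Fintype Ω] (P : Ω → ℝ) (a : Ω) :
    expect P (fun b => ind (b = a)) = P a := by simp [expect, ind]

lemma law_sources1 : law (joint1 W p) (fun ω => ω.1) = piMass (src1Mass p) := by
  funext a
  rw [law_eq_expect, joint1_eq_bind]
  simp only [expect_bind, expect_const (isMass_quant p _), expect_const (isMass_slot1 W _)]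
  exact expect_ind_eq _ _

lemma law_sources2 : law (joint2 W p) (fun ω => ω.1) = piMass (src2Mass p) := by
  funext a
  rw [law_eq_expect, joint2_eq_bind]
  simp only [expect_bind, expect_const (isMass_slot2 W _ _), expect_const (isMass_relay p)]
  exact expect_ind_eq _ _

lemma law_relay : law (joint2 W p) (fun ω => ω.2.1) = relayMass p := by
  funext a
  rw [law_eq_expect, joint2_eq_bind]
  simp only [expect_bind, expect_const (isMass_slot2 W _ _),
    expect_const (IsMass.piMass (isMass_src2 p))]
  exact expect_ind_eq _ _

/-- The quantizer sees only the relay's reception. This is the Markov chain needed for the Markov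
lemma, with `g` extracting the sources and one destination's output. -/
lemma law_quant_markov {α : Type*} (g : (∀ i, X₁ i) → (YR × ∀ k, Y₁ k) → α) (a : α) (r : YR)
    (b : Q) :
    law (joint1 W p) (fun ω => (g ω.1 ω.2.1, ω.2.1.1, ω.2.2)) (a, r, b) =
      law (joint1 W p) (fun ω => (g ω.1 ω.2.1, ω.2.1.1)) (a, r) * quantMass p r b := by
  simp only [law_eq_expect, joint1_eq_bind, expect_bind, expect_const (isMass_quant p _)]
  rw [← expect_mul_right]
  congr 1
  funext x
  rw [← expect_mul_right]
  congr 1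
  funext y
  have : ∀ c, ind ((g x y, y.1, c) = (a, r, b)) = ind ((g x y, y.1) = (a, r)) * ind (c = b) := by
    intro c
    simp only [ind, Prod.mk.injEq]
    split_ifs <;> simp_all
  simp only [this, expect_mul_left, expect_ind_eq]
  by_cases h : (g x y, y.1) = (a, r)
  · rw [(Prod.mk.inj h).2]
  · rw [ind_of_false h, zero_mul, zero_mul]

lemma law_quant_cond (r : YR) (b : Q) :
    law (joint1 W p) (fun ω => (ω.2.1.1, ω.2.2)) (r, b) =
      law (joint1 W p) (fun ω => ω.2.1.1) r * quantMass p r b := by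
  have h := law_quant_markov W p (fun _ _ => ()) () r b
  have h1 := law_comp_injective (joint1 W p) (fun ω => (ω.2.1.1, ω.2.2))
    (Prod.mk_right_injective ()) (r, b)
  have h2 := law_comp_injective (joint1 W p) (fun ω => ω.2.1.1) (Prod.mk_right_injective ()) r
  rw [← h1, ← h2]
  exact h

/-- After averaging over the codebooks, the words of fixed messages and the outputs they cause form
independent letters, distributed as under `joint1`. -/
lemma expect_block1 {M : Fin 2 → ℕ} {n : ℕ} (w : ∀ i, Fin (M i))
    (f : (∀ i, Fin n → X₁ i) → (Fin n → YR × ∀ k, Y₁ k) → ℝ) :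
    expect (bookMass M fun i => piMass fun _ : Fin n => src1Mass p i) (fun c =>
      expect (piMass fun t => slot1Mass W (fun i => c i (w i) t)) (fun y =>
        f (fun i => c i (w i)) y)) =
    expect (piMass fun _ : Fin n => joint1 W p)
      (fun v => f (fun i t => (v t).1 i) (fun t => (v t).2.1)) := by
  rw [expect_bookMass_words (fun i => IsMass.piMass fun _ => isMass_src1 p i) w
      (fun x => expect (piMass fun t => slot1Mass W (fun i => x i t)) (fun y => f x y)),
    expect_piMass_comm,
    expect_piMass_kernel (fun _ : Fin n => piMass (src1Mass p)) (fun _ => slot1Mass W)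
      (fun x y => f (fun i t => x t i) y),
    expect_piMass_map (fun _ : Fin n => joint1 W p) (fun _ ω => (ω.1, ω.2.1))
      (fun v => f (fun i t => (v t).1 i) (fun t => (v t).2))]
  congr 2
  funext t v
  rw [law_eq_expect, joint1_eq_bind]
  simp only [expect_bind, expect_const (isMass_quant p _)]
  have := expect_bind (piMass (src1Mass p)) (slot1Mass W) (fun b => ind (b = v))
  rw [← this, expect_ind_eq]
  rfl

/-- The second-slot counterpart holds for every fixed bin `s`. Hence second-slot bounds are uniform
in the bin, although the bin is determined by the first slot. -/
lemma expect_block2 {M : Fin 2 → ℕ} {S m : ℕ} (w : ∀ i, Fin (M i)) (s : Fin S)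
    (f : (∀ i, Fin m → X₂ i) → (Fin m → XR) → (Fin m → ∀ k, Y₂ k) → ℝ) :
    expect (bookMass M fun i => piMass fun _ : Fin m => src2Mass p i) (fun d =>
      expect (piMass fun _ : Fin S => piMass fun _ : Fin m => relayMass p) (fun r =>
        expect (piMass fun t => slot2Mass W (fun i => d i (w i) t) (r s t)) (fun z =>
          f (fun i => d i (w i)) (r s) z))) =
    expect (piMass fun _ : Fin m => joint2 W p)
      (fun v => f (fun i t => (v t).1 i) (fun t => (v t).2.1) (fun t => (v t).2.2)) := by
  rw [expect_bookMass_words (fun i => IsMass.piMass fun _ => isMass_src2 p i) w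
      (fun x => expect (piMass fun _ : Fin S => piMass fun _ : Fin m => relayMass p) (fun r =>
        expect (piMass fun t => slot2Mass W (fun i => x i t) (r s t)) (fun z => f x (r s) z)))]
  have h1 : ∀ x : ∀ i, Fin m → X₂ i,
      expect (piMass fun _ : Fin S => piMass fun _ : Fin m => relayMass p) (fun r =>
        expect (piMass fun t => slot2Mass W (fun i => x i t) (r s t)) (fun z => f x (r s) z)) =
      expect (piMass fun _ : Fin m => bind (relayMass p) (slot2Mass W (fun i => x i ‹Fin m›)))
        (fun v => f x (fun t => (v t).1) (fun t => (v t).2)) := by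
    intro x
    rw [expect_piMass_eval (fun _ => IsMass.piMass fun _ => isMass_relay p) s (fun b =>
      expect (piMass fun t => slot2Mass W (fun i => x i t) (b t)) (fun z => f x b z)),
      expect_piMass_kernel (fun _ : Fin m => relayMass p)
        (fun t => slot2Mass W (fun i => x i t)) (fun b z => f x b z)]
    rfl
  simp only [h1]
  rw [expect_piMass_comm,
    expect_piMass_kernel (fun _ : Fin m => piMass (src2Mass p))
      (fun _ x => bind (relayMass p) (slot2Mass W x))
      (fun x y => f (fun i t => x t i) (fun t => (y t).1) (fun t => (y t).2)), joint2_eq_bind]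
  rfl

/-! ### Joint typicality, as tested by the relay and in the decoding steps -/

/-- Typicality tested by the relay. -/
def RelayTyp (ε : ℝ) {n : ℕ} (r : Fin n → YR) (b : Fin n → Q) : Prop :=
  Typical (law (joint1 W p) (fun ω => (ω.2.1.1, ω.2.2))) ε (fun t => (r t, b t))

/-- Typicality tested in the first decoding step. -/
def BinTyp (ε : ℝ) {m : ℕ} (k : Fin 2) (b : Fin m → XR) (z : Fin m → Y₂ k) : Prop :=
  Typical (law (joint2 W p) (fun ω => (ω.2.1, ω.2.2 k))) ε (fun t => (b t, z t))

/-- Typicality tested in the second decoding step. -/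
def QuantTyp (ε : ℝ) {n : ℕ} (k : Fin 2) (y : Fin n → Y₁ k) (b : Fin n → Q) : Prop :=
  Typical (law (joint1 W p) (fun ω => (ω.2.1.2 k, ω.2.2))) ε (fun t => (y t, b t))

/-- Typicality tested in the third decoding step, first slot. -/
def MsgTyp1 (ε : ℝ) {n : ℕ} (k : Fin 2) (x : ∀ i, Fin n → X₁ i) (y : Fin n → Y₁ k)
    (b : Fin n → Q) : Prop :=
  Typical (law (joint1 W p) (fun ω => (ω.1, ω.2.1.2 k, ω.2.2))) ε
    (fun t => ((fun i => x i t), y t, b t))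

/-- Typicality tested in the third decoding step, second slot. -/
def MsgTyp2 (ε : ℝ) {m : ℕ} (k : Fin 2) (x : ∀ i, Fin m → X₂ i) (b : Fin m → XR)
    (z : Fin m → Y₂ k) : Prop :=
  Typical (law (joint2 W p) (fun ω => (ω.1, ω.2.1, ω.2.2 k))) ε
    (fun t => ((fun i => x i t), b t, z t))

variable {W p}

lemma MsgTyp1.quantTyp {ε : ℝ} {n : ℕ} {k : Fin 2} {x : ∀ i, Fin n → X₁ i} {y : Fin n → Y₁ k}
    {b : Fin n → Q} (h : MsgTyp1 W p ε k x y b) : QuantTyp W p ε k y b :=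
  Typical.map h Prod.snd

lemma MsgTyp2.binTyp {ε : ℝ} {m : ℕ} {k : Fin 2} {x : ∀ i, Fin m → X₂ i} {b : Fin m → XR}
    {z : Fin m → Y₂ k} (h : MsgTyp2 W p ε k x b z) : BinTyp W p ε k b z :=
  Typical.map h Prod.snd

variable (W p)

/-! ### Exponents -/

/-- Exponent of the probability that an independent word of the codebook of `A` is jointly typical
with `B`. -/
def packRate {Ω α β : Type*} [Fintype Ω] [Fintype α] [Fintype β] (J : Ω → ℝ) (A : Ω → α)
    (B : Ω → β) (ε : ℝ) : ℝ :=
  mutualInfo J A B - ε * infoSlope J A B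

/-- Exponent for a wrong bin. -/
def binRate (ε : ℝ) (k : Fin 2) : ℝ :=
  packRate (joint2 W p) (fun ω => ω.2.1) (fun ω => ω.2.2 k) ε

/-- Exponent for a wrong quantization index. -/
def quantRate (ε : ℝ) (k : Fin 2) : ℝ :=
  packRate (joint1 W p) (fun ω => ω.2.2) (fun ω => ω.2.1.2 k) ε

/-- Exponent of the size of the quantization codebook. -/
def coverRate (ε : ℝ) : ℝ :=
  infoRelayQuant W p + ε * infoSlope (joint1 W p) (fun ω => ω.2.2) (fun ω => ω.2.1.1)

/-- Exponent for one wrong message, first slot. -/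
def oneRate1 (ε : ℝ) (k i : Fin 2) : ℝ :=
  packRate (joint1 W p) (fun ω => ω.1 i) (fun ω => (ω.1 (1 - i), ω.2.1.2 k, ω.2.2)) ε

/-- Exponent for one wrong message, second slot. -/
def oneRate2 (ε : ℝ) (k i : Fin 2) : ℝ :=
  packRate (joint2 W p) (fun ω => ω.1 i) (fun ω => (ω.1 (1 - i), ω.2.1, ω.2.2 k)) ε

/-- Exponent for two wrong messages, first slot. -/
def bothRate1 (ε : ℝ) (k : Fin 2) : ℝ :=
  packRate (joint1 W p) (fun ω => ω.1) (fun ω => (ω.2.1.2 k, ω.2.2)) ε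

/-- Exponent for two wrong messages, second slot. -/
def bothRate2 (ε : ℝ) (k : Fin 2) : ℝ :=
  packRate (joint2 W p) (fun ω => ω.1) (fun ω => (ω.2.1, ω.2.2 k)) ε

/-- Sum of the inverse variances in the Chebyshev bound. -/
def chebConst {Ω α : Type*} [Fintype Ω] [Fintype α] (J : Ω → ℝ) (A : Ω → α) (δ : ℝ) : ℝ :=
  ∑ a, ((δ * law J A a) ^ 2)⁻¹

/-! ### The ensembles of the two slots and the probabilities of their error events. -/

variable (ε' ε : ℝ) {M : Fin 2 → ℕ} {S B n m : ℕ}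

/-- Random codebooks, outputs and quantization index of the first slot. -/
def ensemble1 (w : ∀ i, Fin (M i)) :
    (∀ i, Fin (M i) → Fin n → X₁ i) × (Fin S × Fin B → Fin n → Q) ×
      (Fin n → YR × ∀ k, Y₁ k) × (Fin S × Fin B) → ℝ :=
  bind (bookMass M fun i => piMass fun _ => src1Mass p i) fun c =>
    bind (piMass fun _ => piMass fun _ => law (joint1 W p) (fun ω => ω.2.2)) fun q =>
      bind (piMass fun t => slot1Mass W (fun i => c i (w i) t)) fun y =>
        select (RelayTyp W p ε' (fun t => (y t).1)) q

/-- Random codebooks and outputs of the second slot, when the relay sends the word of bin `s`. -/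
def ensemble2 (w : ∀ i, Fin (M i)) (s : Fin S) :
    (∀ i, Fin (M i) → Fin m → X₂ i) × (Fin S → Fin m → XR) × (Fin m → ∀ k, Y₂ k) → ℝ :=
  bind (bookMass M fun i => piMass fun _ => src2Mass p i) fun d =>
    bind (piMass fun _ => piMass fun _ => relayMass p) fun r =>
      piMass fun t => slot2Mass W (fun i => d i (w i) t) (r s t)

lemma isMass_quantBook : IsMass (piMass fun _ : Fin S × Fin B => piMass fun _ : Fin n =>
    law (joint1 W p) (fun ω => ω.2.2)) :=
  IsMass.piMass fun _ => IsMass.piMass fun _ => (isMass_joint1 W p).law _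

lemma isMass_ensemble1 [NeZero S] [NeZero B] (w : ∀ i, Fin (M i)) :
    IsMass (ensemble1 W p ε' w (S := S) (B := B) (n := n)) :=
  (isMass_bookMass fun i => IsMass.piMass fun _ => isMass_src1 p i).bind fun _ =>
    (isMass_quantBook W p).bind fun _ =>
      (IsMass.piMass fun _ => isMass_slot1 W _).bind fun _ => isMass_select _ _

lemma isMass_ensemble2 (w : ∀ i, Fin (M i)) (s : Fin S) :
    IsMass (ensemble2 W p w s (m := m)) :=
  (isMass_bookMass fun i => IsMass.piMass fun _ => isMass_src2 p i).bind fun _ =>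
    (IsMass.piMass fun _ => IsMass.piMass fun _ => isMass_relay p).bind fun _ =>
      IsMass.piMass fun _ => isMass_slot2 W _ _

/-- Every received word has a suitable quantization codeword with high probability. -/
lemma expect_cover_failure_le [NeZero S] [NeZero B] (hε' : 0 < ε') (hn : 0 < n)
    (w : ∀ i, Fin (M i)) :
    expect (ensemble1 W p ε' w (S := S) (B := B) (n := n)) (fun o =>
      ind (¬ ∃ u, RelayTyp W p ε' (fun t => (o.2.2.1 t).1) (o.2.1 u))) ≤
    2 * (chebConst (joint1 W p) (fun ω => (ω.2.1.1, ω.2.2)) ε' / n) +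
      Real.exp (-((S * B : ℕ) * (2 : ℝ) ^ (-(n * coverRate W p ε')) / 2)) := by
  have h := expect_covering_le (isMass_joint1 W p) (fun ω => ω.2.1.1) (fun ω => ω.2.2)
    (isMass_quant p) (law_quant_cond W p) (U := Fin S × Fin B) hε' hn
  rw [Fintype.card_prod, Fintype.card_fin, Fintype.card_fin] at h
  refine le_trans (le_of_eq ?_) h
  rw [ensemble1]
  simp only [expect_bind, expect_const (isMass_select _ _)]
  refine Eq.trans ?_ (expect_block1 W p w (fun _ y => expect (piMass fun _ : Fin S × Fin B =>
    piMass fun _ : Fin n => law (joint1 W p) (fun ω => ω.2.2)) (fun q =>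
        ind (¬ ∃ u, RelayTyp W p ε' (fun t => (y t).1) (q u)))))
  congr 1
  funext c
  exact expect_comm _ _ _

/-- For each fixed quantization codebook the sources and outputs are independent letters, so this is
the Markov lemma for the selected word, with `A` the sources and the output at destination `k`. -/
lemma expect_msgTyp1_failure_le (hε : ε' < ε) (hn : 0 < n) (k : Fin 2) (w : ∀ i, Fin (M i)) :
    expect (ensemble1 W p ε' w (S := S) (B := B) (n := n)) (fun o =>
      ind (∃ u, RelayTyp W p ε' (fun t => (o.2.2.1 t).1) (o.2.1 u)) *
        ind (¬ MsgTyp1 W p ε k (fun i => o.1 i (w i)) (fun t => (o.2.2.1 t).2 k)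
          (o.2.1 o.2.2.2))) ≤
    chebConst (joint1 W p) (fun ω => ((ω.1, ω.2.1.2 k), ω.2.2)) (ε - ε') / n := by
  rw [ensemble1]
  simp only [expect_bind]
  rw [expect_comm]
  refine expect_le_const (isMass_quantBook W p) fun q => ?_
  refine le_trans ?_ (expect_select_not_typical_le (isMass_joint1 W p) (fun ω => ω.2.1.1)
    (fun ω => (ω.1, ω.2.1.2 k)) (fun ω => ω.2.2)
    (law_quant_markov W p (fun x y => (x, y.2 k))) hε hn q)
  rw [expect_block1 W p w (fun x y => expect (select (RelayTyp W p ε' fun t => (y t).1) q) (fun u =>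
    ind (∃ u, RelayTyp W p ε' (fun t => (y t).1) (q u)) *
      ind (¬ MsgTyp1 W p ε k x (fun t => (y t).2 k) (q u))))]
  refine expect_mono (IsMass.piMass fun _ => isMass_joint1 W p) fun v => ?_
  refine Finset.sum_le_sum fun u _ => ?_
  rw [← mul_assoc, select_mul_ind]
  refine mul_le_mul_of_nonneg_left (ind_mono fun h h' => h ?_) (uniformOn_nonneg _ _ _)
  exact Typical.map h' (fun c => (c.1.1, c.1.2, c.2))

/-- The other indices in the bin of `u`. -/
def binRest (u : Fin S × Fin B) : Finset (Fin S × Fin B) :=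
  (Finset.univ.erase u.2).image (fun b => (u.1, b))

lemma mem_binRest {u u' : Fin S × Fin B} : u' ∈ binRest u ↔ u'.1 = u.1 ∧ u' ≠ u := by
  obtain ⟨s, b⟩ := u
  obtain ⟨s', b'⟩ := u'
  simp only [binRest, Finset.mem_image, Finset.mem_erase, Finset.mem_univ, and_true, Prod.mk.injEq,
    ne_eq]
  constructor
  · rintro ⟨b'', h, rfl, rfl⟩
    exact ⟨rfl, fun h' => h h'.2⟩
  · rintro ⟨rfl, h⟩
    exact ⟨b', fun h' => h ⟨rfl, h'⟩, rfl, rfl⟩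

lemma card_binRest_le (u : Fin S × Fin B) : (binRest u).card ≤ B - 1 := by
  refine Finset.card_image_le.trans ?_
  rw [Finset.card_erase_of_mem (Finset.mem_univ _), Finset.card_univ, Fintype.card_fin]

/-- With source codebooks and outputs fixed, only the quantization words are random. The other `B -
1` words of the bin then behave as fresh ones up to the factor 2, and packing applies to each. -/
lemma expect_quantTyp_wrong_le (k : Fin 2) (w : ∀ i, Fin (M i)) :
    expect (ensemble1 W p ε' w (S := S) (B := B) (n := n)) (fun o =>
      ind (∃ u, RelayTyp W p ε' (fun t => (o.2.2.1 t).1) (o.2.1 u)) *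
        ∑ u' ∈ binRest o.2.2.2, ind (QuantTyp W p ε k (fun t => (o.2.2.1 t).2 k) (o.2.1 u'))) ≤
    2 * ((B - 1 : ℕ) * (2 : ℝ) ^ (-(n * quantRate W p ε k))) := by
  rw [ensemble1]
  simp only [expect_bind]
  refine expect_le_const (isMass_bookMass fun i => IsMass.piMass fun _ => isMass_src1 p i)
    fun c => ?_
  rw [expect_comm]
  refine expect_le_const (IsMass.piMass fun _ => isMass_slot1 W _) fun y => ?_
  have hP : IsMass (piMass fun _ : Fin n => law (joint1 W p) (fun ω => ω.2.2)) :=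
    IsMass.piMass fun _ => (isMass_joint1 W p).law _
  have h := expect_uniformOn_sum_le hP (RelayTyp W p ε' fun t => (y t).1)
    (A := fun b => ind (QuantTyp W p ε k (fun t => (y t).2 k) b)) (fun _ => ind_nonneg _)
    (s := binRest (S := S) (B := B)) (d := B - 1) (fun u hu => (mem_binRest.1 hu).2 rfl)
    card_binRest_le
  calc _ = _ := ?_
    _ ≤ _ := h
    _ ≤ _ := ?_
  · congr 1
    funext q
    refine Finset.sum_congr rfl fun u _ => ?_
    rw [← mul_assoc, select_mul_ind]
  · rw [mul_assoc]
    refine mul_le_mul_of_nonneg_left (mul_le_mul_of_nonneg_left ?_ (Nat.cast_nonneg _)) zero_le_two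
    refine le_trans ?_ (expect_typical_le (isMass_joint1 W p) (fun ω => ω.2.2)
      (fun ω => ω.2.1.2 k) (fun t => (y t).2 k))
    exact expect_mono hP fun b => ind_mono fun h => Typical.map h Prod.swap

/-- Outputs, quantization words and selected index depend on the source codebooks only through the
true words, so the words of wrong messages can be redrawn last. -/
lemma expect_msgTyp1_le {w w' : ∀ i, Fin (M i)} {k : Fin 2} {b : ℝ} [NeZero S] [NeZero B]
    (h : ∀ (x' : ∀ i, Fin n → X₁ i) (y : Fin n → Y₁ k) (a : Fin n → Q),
      expect (piMass fun i => piMass fun _ : Fin n => src1Mass p i)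
        (fun x => ind (MsgTyp1 W p ε k (fun i => if w' i = w i then x' i else x i) y a)) ≤ b) :
    expect (ensemble1 W p ε' w (S := S) (B := B) (n := n)) (fun o =>
      ind (MsgTyp1 W p ε k (fun i => o.1 i (w' i)) (fun t => (o.2.2.1 t).2 k)
        (o.2.1 o.2.2.2))) ≤ b := by
  rw [ensemble1, expect_bind]
  refine expect_bookMass_le (fun i => IsMass.piMass fun _ => isMass_src1 p i) w w'
    (G := fun x x' => expect (bind (piMass fun _ => piMass fun _ =>
        law (joint1 W p) (fun ω => ω.2.2)) fun q =>
      bind (piMass fun t => slot1Mass W (fun i => x i t)) fun y =>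
        select (RelayTyp W p ε' (fun t => (y t).1)) q) (fun o =>
      ind (MsgTyp1 W p ε k x' (fun t => (o.2.1 t).2 k) (o.1 o.2.2)))) fun x x' => ?_
  rw [expect_comm]
  refine expect_le_const ((isMass_quantBook W p).bind fun _ =>
      (IsMass.piMass fun _ => isMass_slot1 W _).bind fun _ => isMass_select _ _) fun o => ?_
  exact h _ _ _

lemma expect_msgTyp2_failure_le (hε : 0 < ε) (hm : 0 < m) (k : Fin 2) (w : ∀ i, Fin (M i))
    (s : Fin S) :
    expect (ensemble2 W p w s (m := m)) (fun o =>
      ind (¬ MsgTyp2 W p ε k (fun i => o.1 i (w i)) (o.2.1 s) (fun t => o.2.2 t k))) ≤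
    chebConst (joint2 W p) (fun ω => (ω.1, ω.2.1, ω.2.2 k)) ε / m := by
  refine le_trans (le_of_eq ?_) (expect_not_typical_iid_le hm (isMass_joint2 W p)
    (fun ω => (ω.1, ω.2.1, ω.2.2 k)) hε)
  rw [ensemble2]
  simp only [expect_bind]
  exact expect_block2 W p w s (fun x b z => ind (¬ MsgTyp2 W p ε k x b (fun t => z t k)))

/-- The second-slot outputs depend on the relay codebook only through the word of bin `s`. The word
of any other bin can therefore be redrawn against fixed outputs. -/
lemma expect_binTyp_wrong_le (k : Fin 2) (w : ∀ i, Fin (M i)) (s : Fin S) :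
    expect (ensemble2 W p w s (m := m)) (fun o =>
      ∑ s' ∈ Finset.univ.erase s, ind (BinTyp W p ε k (o.2.1 s') (fun t => o.2.2 t k))) ≤
    (S - 1 : ℕ) * (2 : ℝ) ^ (-(m * binRate W p ε k)) := by
  rw [expect_sum]
  have hcard : (Finset.univ.erase s).card = S - 1 := by
    rw [Finset.card_erase_of_mem (Finset.mem_univ _), Finset.card_univ, Fintype.card_fin]
  rw [← hcard, ← nsmul_eq_mul, ← Finset.sum_const]
  refine Finset.sum_le_sum fun s' hs' => ?_
  have hss := Finset.ne_of_mem_erase hs'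
  rw [ensemble2]
  simp only [expect_bind]
  refine expect_le_const (isMass_bookMass fun i => IsMass.piMass fun _ => isMass_src2 p i)
    fun d => ?_
  have hr : IsMass (piMass fun _ : Fin m => relayMass p) := IsMass.piMass fun _ => isMass_relay p
  rw [← expect_piMass_update (fun _ => hr) s']
  refine expect_le_const (IsMass.piMass fun _ => hr) fun r => ?_
  simp only [Function.update_self, Function.update_of_ne hss.symm]
  rw [expect_comm]
  refine expect_le_const (IsMass.piMass fun _ => isMass_slot2 W _ _) fun z => ?_
  have h := expect_typical_le (isMass_joint2 W p) (fun ω => ω.2.1) (fun ω => ω.2.2 k) (ε := ε)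
    (fun t => z t k)
  rw [law_relay] at h
  exact h

lemma expect_msgTyp2_le {w w' : ∀ i, Fin (M i)} {k : Fin 2} {c : ℝ} {s : Fin S}
    (h : ∀ (x' : ∀ i, Fin m → X₂ i) (b : Fin m → XR) (z : Fin m → Y₂ k),
      expect (piMass fun i => piMass fun _ : Fin m => src2Mass p i)
        (fun x => ind (MsgTyp2 W p ε k (fun i => if w' i = w i then x' i else x i) b z)) ≤ c) :
    expect (ensemble2 W p w s (m := m)) (fun o =>
      ind (MsgTyp2 W p ε k (fun i => o.1 i (w' i)) (o.2.1 s) (fun t => o.2.2 t k))) ≤ c := by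
  rw [ensemble2, expect_bind]
  refine expect_bookMass_le (fun i => IsMass.piMass fun _ => isMass_src2 p i) w w'
    (G := fun x x' => expect (bind (piMass fun _ => piMass fun _ => relayMass p) fun r =>
      piMass fun t => slot2Mass W (fun i => x i t) (r s t)) (fun o =>
      ind (MsgTyp2 W p ε k x' (o.1 s) (fun t => o.2 t k)))) fun x x' => ?_
  rw [expect_comm]
  refine expect_le_const ((IsMass.piMass fun _ => IsMass.piMass fun _ => isMass_relay p).bind
    fun _ => IsMass.piMass fun _ => isMass_slot2 W _ _) fun o => ?_
  exact h _ _ _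

lemma expect_msgTyp1_one_le (k i : Fin 2) {w : ∀ i, Fin (M i)} {v : Fin (M i)} (hv : v ≠ w i)
    [NeZero S] [NeZero B] :
    expect (ensemble1 W p ε' w (S := S) (B := B) (n := n)) (fun o =>
      ind (MsgTyp1 W p ε k (fun j => o.1 j (Function.update w i v j))
        (fun t => (o.2.2.1 t).2 k) (o.2.1 o.2.2.2))) ≤
      (2 : ℝ) ^ (-(n * oneRate1 W p ε k i)) := by
  refine expect_msgTyp1_le W p ε' ε fun x' y a => ?_
  have h := expect_source_typical_le (isMass_joint1 W p) (isMass_src1 p) (law_sources1 W p)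
    (fun ω => (ω.2.1.2 k, ω.2.2)) (ε := ε) i x' (fun t => (y t, a t))
  have e : ∀ j, (Function.update w i v j = w j) ↔ j ≠ i := by
    intro j
    by_cases hj : j = i
    · subst hj; simpa using hv
    · simp [hj]
  simp only [e]
  exact h

lemma expect_msgTyp2_one_le (k i : Fin 2) {w : ∀ i, Fin (M i)} {v : Fin (M i)} (hv : v ≠ w i)
    (s : Fin S) :
    expect (ensemble2 W p w s (m := m)) (fun o =>
      ind (MsgTyp2 W p ε k (fun j => o.1 j (Function.update w i v j)) (o.2.1 s)
        (fun t => o.2.2 t k))) ≤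
      (2 : ℝ) ^ (-(m * oneRate2 W p ε k i)) := by
  refine expect_msgTyp2_le W p ε fun x' b z => ?_
  have h := expect_source_typical_le (isMass_joint2 W p) (isMass_src2 p) (law_sources2 W p)
    (fun ω => (ω.2.1, ω.2.2 k)) (ε := ε) i x' (fun t => (b t, z t))
  have e : ∀ j, (Function.update w i v j = w j) ↔ j ≠ i := by
    intro j
    by_cases hj : j = i
    · subst hj; simpa using hv
    · simp [hj]
  simp only [e]
  exact h

lemma expect_msgTyp1_both_le (k : Fin 2) {w w' : ∀ i, Fin (M i)} (hw : ∀ i, w' i ≠ w i)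
    [NeZero S] [NeZero B] :
    expect (ensemble1 W p ε' w (S := S) (B := B) (n := n)) (fun o =>
      ind (MsgTyp1 W p ε k (fun j => o.1 j (w' j)) (fun t => (o.2.2.1 t).2 k)
        (o.2.1 o.2.2.2))) ≤
      (2 : ℝ) ^ (-(n * bothRate1 W p ε k)) := by
  refine expect_msgTyp1_le W p ε' ε fun x' y a => ?_
  simp only [hw, if_false]
  exact expect_sources_typical_le (isMass_joint1 W p) (law_sources1 W p)
    (fun ω => (ω.2.1.2 k, ω.2.2)) (ε := ε) (fun t => (y t, a t))

lemma expect_msgTyp2_both_le (k : Fin 2) {w w' : ∀ i, Fin (M i)} (hw : ∀ i, w' i ≠ w i)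
    (s : Fin S) :
    expect (ensemble2 W p w s (m := m)) (fun o =>
      ind (MsgTyp2 W p ε k (fun j => o.1 j (w' j)) (o.2.1 s) (fun t => o.2.2 t k))) ≤
      (2 : ℝ) ^ (-(m * bothRate2 W p ε k)) := by
  refine expect_msgTyp2_le W p ε fun x' b z => ?_
  simp only [hw, if_false]
  exact expect_sources_typical_le (isMass_joint2 W p) (law_sources2 W p)
    (fun ω => (ω.2.1, ω.2.2 k)) (ε := ε) (fun t => (b t, z t))

end

/-! ### From the ensemble to a code -/

lemma not_of_ind_lt {P : Prop} {b : ℝ} (h : ind P ≤ b) (hb : b < 1) : ¬ P := fun hP => by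
  rw [ind_of_true hP] at h
  linarith

lemma theUnique_eq {α : Type*} {d a : α} {P : α → Prop} (h : P a) (hu : ∀ a', P a' → a' = a) :
    theUnique d P = a := by
  have hex : ∃! a, P a := ⟨a, h, hu⟩
  rw [theUnique, dif_pos hex]
  exact hu _ hex.choose_spec.1

/-- A pair of messages that is not the true one differs in one component or in both. -/
lemma sum_ne_le {M : Fin 2 → ℕ} (w : ∀ i, Fin (M i)) {f : (∀ i, Fin (M i)) → ℝ}
    (hf : ∀ w', 0 ≤ f w') :
    ∑ w' ∈ Finset.univ.erase w, f w' ≤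
      ∑ i, ∑ v ∈ Finset.univ.erase (w i), f (Function.update w i v) +
        ∑ w' ∈ Fintype.piFinset (fun i => Finset.univ.erase (w i)), f w' := by
  set T : Finset (∀ i, Fin (M i)) := Fintype.piFinset fun i => Finset.univ.erase (w i) with hT
  rw [← Finset.sum_inter_add_sum_sdiff (Finset.univ.erase w) T, add_comm]
  refine add_le_add ?_
    (Finset.sum_le_sum_of_subset_of_nonneg Finset.inter_subset_right fun _ _ _ => hf _)
  have hsum : ∀ i, ∑ v ∈ Finset.univ.erase (w i), f (Function.update w i v) =
      ∑ w' ∈ (Finset.univ.erase (w i)).image (Function.update w i), f w' := by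
    intro i
    rw [Finset.sum_image fun a _ b _ h => Function.update_injective w i h]
  simp only [hsum]
  rw [Fin.sum_univ_two]
  refine le_trans ?_ (Finset.sum_union_inter (f := f)
    (s₁ := (Finset.univ.erase (w 0)).image (Function.update w 0))
    (s₂ := (Finset.univ.erase (w 1)).image (Function.update w 1))).le
  refine le_add_of_le_of_nonneg ?_ (Finset.sum_nonneg fun _ _ => hf _)
  refine Finset.sum_le_sum_of_subset_of_nonneg (fun w' hw' => ?_) fun _ _ _ => hf _
  simp only [hT, Finset.mem_sdiff, Finset.mem_erase, Finset.mem_univ, and_true,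
    Fintype.mem_piFinset, not_forall, not_not] at hw'
  obtain ⟨hne, i, hi⟩ := hw'
  simp only [Finset.mem_union, Finset.mem_image, Finset.mem_erase, Finset.mem_univ, and_true]
  -- With only two sources, a pair agreeing with `w` at `i` is obtained from `w` by changing the
  -- other component.
  have hupd : ∀ j, j ≠ i → Function.update w j (w' j) = w' ∧ w' j ≠ w j := by
    intro j hj
    have h1 : Function.update w j (w' j) = w' := by
      funext l
      by_cases hl : l = j
      · subst hl; simp
      · have : l = i := by omega
        subst this
        rw [Function.update_of_ne hl, hi]
    exact ⟨h1, fun h => hne (by rw [← h1, h, Function.update_eq_self])⟩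
  fin_cases i
  · obtain ⟨h1, h2⟩ := hupd 1 (by decide)
    exact Or.inr ⟨w' 1, h2, h1⟩
  · obtain ⟨h1, h2⟩ := hupd 0 (by decide)
    exact Or.inl ⟨w' 0, h2, h1⟩

/-- Derandomized selection. -/
lemma exists_pick {Y T U : Type*} [Fintype Y] [Fintype T] [Fintype U] (π : Y → T)
    {sel : T → U → ℝ} (hsel : ∀ r, IsMass (sel r)) (G : Y → U → ℝ) :
    ∃ pick : T → U, (∀ r, 0 < sel r (pick r)) ∧
      ∑ y, G y (pick (π y)) ≤ ∑ y, expect (sel (π y)) (G y) := by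
  -- The choice may depend only on `r = π y`, so the costs of all `y` with that value are added
  -- before an index not above the mean is taken.
  choose pick h1 h2 using fun r => exists_le_expect (hsel r)
    (fun u => ∑ y ∈ Finset.univ.filter (fun y => π y = r), G y u)
  refine ⟨pick, h1, ?_⟩
  rw [← Finset.sum_fiberwise Finset.univ π, ← Finset.sum_fiberwise Finset.univ π]
  refine Finset.sum_le_sum fun r _ => ?_
  have h3 := h2 r
  rw [expect_sum] at h3
  calc _ = _ := Finset.sum_congr rfl fun y hy => by rw [(Finset.mem_filter.1 hy).2]
    _ ≤ _ := h3
    _ = _ := Finset.sum_congr rfl fun y hy => by rw [(Finset.mem_filter.1 hy).2]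

/-- Reconciles two orders of sampling: second-slot codebooks drawn before the first-slot output and
the selection, or after them. -/
lemma expect_comm_bind {Ω₁ Ω₂ Ω₃ Ω₄ : Type*} [Fintype Ω₁] [Fintype Ω₂] [Fintype Ω₃] [Fintype Ω₄]
    (p : Ω₁ → ℝ) (k : Ω₁ → Ω₂ → ℝ) (d : Ω₃ → ℝ) (r : Ω₄ → ℝ) (G : Ω₁ → Ω₂ → Ω₃ → Ω₄ → ℝ) :
    expect p (fun y => expect (k y) fun u => expect d fun a => expect r fun b => G y u a b) =
      expect d (fun a => expect r fun b => expect p fun y => expect (k y) fun u => G y u a b) := by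
  have h1 := fun a b => expect_bind p k (fun v => G v.1 v.2 a b)
  have h2 := fun y u => expect_bind d (fun _ => r) (fun v => G y u v.1 v.2)
  simp only at h1 h2
  simp only [← h1, ← h2]
  have h3 := expect_bind p k (fun v => expect (bind d fun _ => r) fun c => G v.1 v.2 c.1 c.2)
  have h4 := expect_bind d (fun _ => r) (fun c => expect (bind p k) fun v => G v.1 v.2 c.1 c.2)
  simp only at h3 h4
  rw [← h3, ← h4, expect_comm]

/-! ### The union bound and the extraction of a deterministic code. -/

section

variable {X₁ X₂ : Fin 2 → Type*} {XR YR Q : Type*} {Y₁ Y₂ : Fin 2 → Type*}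
  [∀ i, Fintype (X₁ i)] [∀ i, Fintype (X₂ i)] [Fintype XR] [Fintype YR] [Fintype Q]
  [∀ k, Fintype (Y₁ k)] [∀ k, Fintype (Y₂ k)]
  (W : Channel X₁ X₂ XR YR Y₁ Y₂) (p : InputDist X₁ X₂ XR YR Q)
  (ε' ε : ℝ) {M : Fin 2 → ℕ} {S B n m : ℕ}

/-- The part of the union bound that concerns destination `k`. -/
def badnessAt (k : Fin 2) (w : ∀ i, Fin (M i))
    (o₁ : (∀ i, Fin (M i) → Fin n → X₁ i) × (Fin S × Fin B → Fin n → Q) ×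
      (Fin n → YR × ∀ k, Y₁ k) × (Fin S × Fin B))
    (o₂ : (∀ i, Fin (M i) → Fin m → X₂ i) × (Fin S → Fin m → XR) × (Fin m → ∀ k, Y₂ k)) : ℝ :=
  ind (∃ u, RelayTyp W p ε' (fun t => (o₁.2.2.1 t).1) (o₁.2.1 u)) *
      ind (¬ MsgTyp1 W p ε k (fun i => o₁.1 i (w i)) (fun t => (o₁.2.2.1 t).2 k)
        (o₁.2.1 o₁.2.2.2)) +
    ind (¬ MsgTyp2 W p ε k (fun i => o₂.1 i (w i)) (o₂.2.1 o₁.2.2.2.1) (fun t => o₂.2.2 t k)) +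
    ∑ s' ∈ Finset.univ.erase o₁.2.2.2.1,
      ind (BinTyp W p ε k (o₂.2.1 s') (fun t => o₂.2.2 t k)) +
    ind (∃ u, RelayTyp W p ε' (fun t => (o₁.2.2.1 t).1) (o₁.2.1 u)) *
      ∑ u' ∈ binRest o₁.2.2.2,
        ind (QuantTyp W p ε k (fun t => (o₁.2.2.1 t).2 k) (o₁.2.1 u')) +
    ∑ w' ∈ Finset.univ.erase w,
      ind (MsgTyp1 W p ε k (fun i => o₁.1 i (w' i)) (fun t => (o₁.2.2.1 t).2 k)
        (o₁.2.1 o₁.2.2.2)) *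
      ind (MsgTyp2 W p ε k (fun i => o₂.1 i (w' i)) (o₂.2.1 o₁.2.2.2.1) (fun t => o₂.2.2 t k))

/-- The union bound on the indicator of a decoding error. -/
def badness (w : ∀ i, Fin (M i))
    (o₁ : (∀ i, Fin (M i) → Fin n → X₁ i) × (Fin S × Fin B → Fin n → Q) ×
      (Fin n → YR × ∀ k, Y₁ k) × (Fin S × Fin B))
    (o₂ : (∀ i, Fin (M i) → Fin m → X₂ i) × (Fin S → Fin m → XR) × (Fin m → ∀ k, Y₂ k)) : ℝ :=
  ind (¬ ∃ u, RelayTyp W p ε' (fun t => (o₁.2.2.1 t).1) (o₁.2.1 u)) +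
    ∑ k, badnessAt W p ε' ε k w o₁ o₂

/-- The bound on the average error probability of the random code, at destination `k`. -/
def errorBoundAt (k : Fin 2) (M : Fin 2 → ℕ) (S B n m : ℕ) : ℝ :=
  chebConst (joint1 W p) (fun ω => ((ω.1, ω.2.1.2 k), ω.2.2)) (ε - ε') / n +
    chebConst (joint2 W p) (fun ω => (ω.1, ω.2.1, ω.2.2 k)) ε / m +
    (S - 1 : ℕ) * (2 : ℝ) ^ (-(m * binRate W p ε k)) +
    2 * ((B - 1 : ℕ) * (2 : ℝ) ^ (-(n * quantRate W p ε k))) +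
    (∑ i, (M i - 1 : ℕ) *
      ((2 : ℝ) ^ (-(n * oneRate1 W p ε k i)) * (2 : ℝ) ^ (-(m * oneRate2 W p ε k i))) +
    (∏ i, (M i - 1) : ℕ) *
      ((2 : ℝ) ^ (-(n * bothRate1 W p ε k)) * (2 : ℝ) ^ (-(m * bothRate2 W p ε k))))

/-- The bound on the average error probability of the random code. -/
def errorBound (M : Fin 2 → ℕ) (S B n m : ℕ) : ℝ :=
  2 * (chebConst (joint1 W p) (fun ω => (ω.2.1.1, ω.2.2)) ε' / n) +
    Real.exp (-((S * B : ℕ) * (2 : ℝ) ^ (-(n * coverRate W p ε')) / 2)) +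
    ∑ k, errorBoundAt W p ε' ε k M S B n m

/-- The whole random experiment, for the messages `w`. -/
def ensemble (n m : ℕ) (w : ∀ i, Fin (M i)) :
    ((∀ i, Fin (M i) → Fin n → X₁ i) × (Fin S × Fin B → Fin n → Q) ×
      (Fin n → YR × ∀ k, Y₁ k) × (Fin S × Fin B)) ×
    ((∀ i, Fin (M i) → Fin m → X₂ i) × (Fin S → Fin m → XR) × (Fin m → ∀ k, Y₂ k)) → ℝ :=
  bind (ensemble1 W p ε' w) fun o => ensemble2 W p w o.2.2.2.1

variable [NeZero S] [NeZero B]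

lemma isMass_ensemble (w : ∀ i, Fin (M i)) :
    IsMass (ensemble W p ε' (S := S) (B := B) n m w) :=
  (isMass_ensemble1 W p ε' w).bind fun _ => isMass_ensemble2 W p w _

/-- The second slot depends on the first only through the bin. A second-slot bound valid for every
bin therefore multiplies the first-slot bound, and the exponents of the two slots add. -/
lemma expect_ensemble_mul_le {w : ∀ i, Fin (M i)}
    {f : (∀ i, Fin (M i) → Fin n → X₁ i) × (Fin S × Fin B → Fin n → Q) ×
      (Fin n → YR × ∀ k, Y₁ k) × (Fin S × Fin B) → ℝ}
    {g : Fin S → (∀ i, Fin (M i) → Fin m → X₂ i) × (Fin S → Fin m → XR) ×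
      (Fin m → ∀ k, Y₂ k) → ℝ} {b c : ℝ} (hf : ∀ o, 0 ≤ f o) (hc : 0 ≤ c)
    (hfb : expect (ensemble1 W p ε' w) f ≤ b) (hgc : ∀ s, expect (ensemble2 W p w s) (g s) ≤ c) :
    expect (ensemble W p ε' n m w) (fun o => f o.1 * g o.1.2.2.2.1 o.2) ≤ b * c := by
  rw [ensemble, expect_bind]
  refine le_trans ?_ (mul_le_mul_of_nonneg_right hfb hc)
  rw [← expect_mul_right]
  refine expect_mono (isMass_ensemble1 W p ε' w) fun o => ?_
  simp only [expect_mul_left]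
  exact mul_le_mul_of_nonneg_left (hgc _) (hf o)

lemma expect_ensemble_fst {w : ∀ i, Fin (M i)}
    (f : (∀ i, Fin (M i) → Fin n → X₁ i) × (Fin S × Fin B → Fin n → Q) ×
      (Fin n → YR × ∀ k, Y₁ k) × (Fin S × Fin B) → ℝ) :
    expect (ensemble W p ε' n m w) (fun o => f o.1) = expect (ensemble1 W p ε' w) f := by
  rw [ensemble, expect_bind]
  simp only [expect_const (isMass_ensemble2 W p w _)]

lemma expect_ensemble_snd_le {w : ∀ i, Fin (M i)}
    {g : Fin S → (∀ i, Fin (M i) → Fin m → X₂ i) × (Fin S → Fin m → XR) ×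
      (Fin m → ∀ k, Y₂ k) → ℝ} {c : ℝ} (hgc : ∀ s, expect (ensemble2 W p w s) (g s) ≤ c) :
    expect (ensemble W p ε' (B := B) n m w) (fun o => g o.1.2.2.2.1 o.2) ≤ c := by
  rw [ensemble, expect_bind]
  exact expect_le_const (isMass_ensemble1 W p ε' w) fun o => hgc _

lemma expect_badnessAt_le (hε' : 0 < ε') (hε : ε' < ε) (hn : 0 < n) (hm : 0 < m)
    (k : Fin 2) (w : ∀ i, Fin (M i)) :
    expect (ensemble W p ε' (S := S) (B := B) n m w)
      (fun o => badnessAt W p ε' ε k w o.1 o.2) ≤ errorBoundAt W p ε' ε k M S B n m := by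
  simp only [badnessAt, expect_add]
  refine add_le_add (add_le_add (add_le_add (add_le_add ?_ ?_) ?_) ?_) ?_
  · exact (expect_ensemble_fst W p ε' _).trans_le
      (expect_msgTyp1_failure_le W p ε' ε hε hn k w)
  · exact expect_ensemble_snd_le W p ε' fun s =>
      expect_msgTyp2_failure_le W p ε (hε'.trans hε) hm k w s
  · exact expect_ensemble_snd_le W p ε'
      (g := fun s o => ∑ s' ∈ Finset.univ.erase s,
        ind (BinTyp W p ε k (o.2.1 s') (fun t => o.2.2 t k)))
      fun s => expect_binTyp_wrong_le W p ε k w s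
  · exact (expect_ensemble_fst W p ε' _).trans_le (expect_quantTyp_wrong_le W p ε' ε k w)
  · rw [expect_sum]
    refine (sum_ne_le w fun w' => expect_nonneg (isMass_ensemble W p ε' w) fun o =>
      mul_nonneg (ind_nonneg _) (ind_nonneg _)).trans (add_le_add ?_ ?_)
    · refine Finset.sum_le_sum fun i _ => ?_
      have hcard : (Finset.univ.erase (w i)).card = M i - 1 := by
        rw [Finset.card_erase_of_mem (Finset.mem_univ _), Finset.card_univ, Fintype.card_fin]
      rw [← hcard, ← nsmul_eq_mul, ← Finset.sum_const]
      refine Finset.sum_le_sum fun v hv => ?_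
      have hv' := Finset.ne_of_mem_erase hv
      exact expect_ensemble_mul_le W p ε' (fun _ => ind_nonneg _) (by positivity)
        (expect_msgTyp1_one_le W p ε' ε k i hv')
        (fun s => expect_msgTyp2_one_le W p ε k i hv' s)
    · have hcard : (Fintype.piFinset fun i => Finset.univ.erase (w i)).card = ∏ i, (M i - 1) := by
        rw [Fintype.card_piFinset]
        refine Finset.prod_congr rfl fun i _ => ?_
        rw [Finset.card_erase_of_mem (Finset.mem_univ _), Finset.card_univ, Fintype.card_fin]
      rw [← hcard, ← nsmul_eq_mul, ← Finset.sum_const]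
      refine Finset.sum_le_sum fun w' hw' => ?_
      have hw : ∀ i, w' i ≠ w i := fun i =>
        Finset.ne_of_mem_erase (Fintype.mem_piFinset.1 hw' i)
      exact expect_ensemble_mul_le W p ε' (fun _ => ind_nonneg _) (by positivity)
        (expect_msgTyp1_both_le W p ε' ε k hw) (fun s => expect_msgTyp2_both_le W p ε k hw s)

lemma expect_badness_le (hε' : 0 < ε') (hε : ε' < ε) (hn : 0 < n) (hm : 0 < m)
    (w : ∀ i, Fin (M i)) :
    expect (ensemble W p ε' (S := S) (B := B) n m w)
      (fun o => badness W p ε' ε w o.1 o.2) ≤ errorBound W p ε' ε M S B n m := by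
  simp only [badness, expect_add, expect_sum]
  refine add_le_add ?_ (Finset.sum_le_sum fun k _ =>
    expect_badnessAt_le W p ε' ε hε' hε hn hm k w)
  exact (expect_ensemble_fst W p ε' _).trans_le (expect_cover_failure_le W p ε' hε' hn w)

lemma badnessAt_nonneg (k : Fin 2) (w : ∀ i, Fin (M i))
    (o₁ : (∀ i, Fin (M i) → Fin n → X₁ i) × (Fin S × Fin B → Fin n → Q) ×
      (Fin n → YR × ∀ k, Y₁ k) × (Fin S × Fin B))
    (o₂ : (∀ i, Fin (M i) → Fin m → X₂ i) × (Fin S → Fin m → XR) × (Fin m → ∀ k, Y₂ k)) :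
    0 ≤ badnessAt W p ε' ε k w o₁ o₂ := by
  have h := fun P => ind_nonneg P
  refine add_nonneg (add_nonneg (add_nonneg (add_nonneg ?_ (h _)) ?_) ?_) ?_
  · exact mul_nonneg (h _) (h _)
  · exact Finset.sum_nonneg fun _ _ => h _
  · exact mul_nonneg (h _) (Finset.sum_nonneg fun _ _ => h _)
  · exact Finset.sum_nonneg fun _ _ => mul_nonneg (h _) (h _)

variable {W p ε'}

/-- All terms of `badness` are indicators, products of indicators or sums of these. If the total is
below 1, they all vanish, and then in each of the three decoding steps the true candidate passes the
test and is the only one to do so. -/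
lemma ind_error_le_badness [∀ i, NeZero (M i)] (C : CFCode W p ε' M S B n m)
    (w : ∀ i, Fin (M i)) (y : Fin n → YR × ∀ k, Y₁ k) (z : Fin m → ∀ k, Y₂ k) :
    ind (∃ k, (C.toCode ε).dec k (fun t => (y t).2 k) (fun t => z t k) ≠ w) ≤
      badness W p ε' ε w (C.src1, C.quantWord, y, C.pick fun t => (y t).1)
        (C.src2, C.relayWord, z) := by
  set u := C.pick fun t => (y t).1 with hu
  have hsum : 0 ≤ ∑ k, badnessAt W p ε' ε k w (C.src1, C.quantWord, y, u)
      (C.src2, C.relayWord, z) := Finset.sum_nonneg fun k _ => badnessAt_nonneg W p ε' ε k w _ _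
  refine ind_le_of_imp (add_nonneg (ind_nonneg _) hsum) ?_
  rintro ⟨k, hk⟩
  by_contra! hlt
  apply hk
  have h0 : ¬ ¬ ∃ u, RelayTyp W p ε' (fun t => (y t).1) (C.quantWord u) :=
    not_of_ind_lt (le_add_of_nonneg_right hsum) hlt
  have hk1 : badnessAt W p ε' ε k w (C.src1, C.quantWord, y, u) (C.src2, C.relayWord, z) < 1 := by
    refine lt_of_le_of_lt ?_ hlt
    refine le_add_of_nonneg_of_le (ind_nonneg _) ?_
    exact Finset.single_le_sum (f := fun k => badnessAt W p ε' ε k w (C.src1, C.quantWord, y, u)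
      (C.src2, C.relayWord, z)) (fun k _ => badnessAt_nonneg W p ε' ε k w _ _) (Finset.mem_univ k)
  simp only [badnessAt, ind_of_true (not_not.1 h0), one_mul] at hk1
  have n1 := ind_nonneg (¬ MsgTyp1 W p ε k (fun i => C.src1 i (w i)) (fun t => (y t).2 k)
    (C.quantWord u))
  have n2 := ind_nonneg (¬ MsgTyp2 W p ε k (fun i => C.src2 i (w i)) (C.relayWord u.1)
    (fun t => z t k))
  have n3 : ∀ s' ∈ Finset.univ.erase u.1,
    0 ≤ ind (BinTyp W p ε k (C.relayWord s') (fun t => z t k)) := fun _ _ => ind_nonneg _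
  have n4 : ∀ u' ∈ binRest u,
    0 ≤ ind (QuantTyp W p ε k (fun t => (y t).2 k) (C.quantWord u')) := fun _ _ => ind_nonneg _
  have n5 : ∀ w' ∈ Finset.univ.erase w,
      0 ≤ ind (MsgTyp1 W p ε k (fun i => C.src1 i (w' i)) (fun t => (y t).2 k) (C.quantWord u)) *
        ind (MsgTyp2 W p ε k (fun i => C.src2 i (w' i)) (C.relayWord u.1) (fun t => z t k)) :=
    fun _ _ => mul_nonneg (ind_nonneg _) (ind_nonneg _)
  have m3 := Finset.sum_nonneg n3
  have m4 := Finset.sum_nonneg n4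
  have m5 := Finset.sum_nonneg n5
  have t1 : MsgTyp1 W p ε k (fun i => C.src1 i (w i)) (fun t => (y t).2 k) (C.quantWord u) :=
    not_not.1 (not_of_ind_lt le_rfl (by linarith))
  have t2 : MsgTyp2 W p ε k (fun i => C.src2 i (w i)) (C.relayWord u.1) (fun t => z t k) :=
    not_not.1 (not_of_ind_lt le_rfl (by linarith))
  have hs : C.decBin ε k (fun t => z t k) = u.1 := by
    refine theUnique_eq t2.binTyp fun s' hs' => ?_
    by_contra hne
    exact not_of_ind_lt (Finset.single_le_sum n3
      (Finset.mem_erase.2 ⟨hne, Finset.mem_univ _⟩)) (by linarith) hs'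
  have hq : C.decQuant ε k u.1 (fun t => (y t).2 k) = u := by
    refine theUnique_eq ⟨rfl, t1.quantTyp⟩ fun u' hu' => ?_
    by_contra hne
    exact not_of_ind_lt (Finset.single_le_sum n4
      (mem_binRest.2 ⟨hu'.1, hne⟩)) (by linarith) hu'.2
  change C.decMsg ε k (C.decBin ε k fun t => z t k)
    (C.decQuant ε k (C.decBin ε k fun t => z t k) fun t => (y t).2 k) _ _ = w
  rw [hs, hq]
  refine theUnique_eq ⟨t1, t2⟩ fun w' hw' => ?_
  by_contra hne
  have h5 := Finset.single_le_sum n5 (Finset.mem_erase.2 ⟨hne, Finset.mem_univ _⟩)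
  have a1 : MsgTyp1 W p ε k (fun i => C.src1 i (w' i)) (fun t => (y t).2 k) (C.quantWord u) := hw'.1
  have a2 : MsgTyp2 W p ε k (fun i => C.src2 i (w' i)) (C.relayWord u.1) (fun t => z t k) := hw'.2
  rw [ind_of_true a1, ind_of_true a2] at h5
  linarith

variable (W p ε')

lemma isMass_uniform [∀ i, NeZero (M i)] :
    IsMass (fun _ : ∀ i, Fin (M i) => (∏ i, (M i : ℝ))⁻¹) := by
  refine ⟨fun _ => by positivity, ?_⟩
  rw [Finset.sum_const, Finset.card_univ, Fintype.card_pi, nsmul_eq_mul]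
  simp only [Fintype.card_fin]
  rw [Nat.cast_prod, mul_inv_cancel₀]
  exact Finset.prod_ne_zero_iff.2 fun i _ => Nat.cast_ne_zero.2 (NeZero.ne _)

/-- Averaging over uniform messages before fixing the codebooks gives one set of codebooks good for
all messages on average. The random selection is then replaced by a deterministic one of positive
probability, hence one that obeys the relay's typicality rule. -/
lemma exists_code_errorProb_le [∀ i, NeZero (M i)] (hε' : 0 < ε') (hε : ε' < ε) (hn : 0 < n)
    (hm : 0 < m) :
    ∃ C : CFCode W p ε' M S B n m,
      (C.toCode ε).errorProb W ≤ errorBound W p ε' ε M S B n m := by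
  have hU := isMass_uniform (M := M)
  set U : (∀ i, Fin (M i)) → ℝ := fun _ => (∏ i, (M i : ℝ))⁻¹ with hUdef
  have hC : IsMass (bookMass M fun i => piMass fun _ : Fin n => src1Mass p i) :=
    isMass_bookMass fun i => IsMass.piMass fun _ => isMass_src1 p i
  have hD : IsMass (bookMass M fun i => piMass fun _ : Fin m => src2Mass p i) :=
    isMass_bookMass fun i => IsMass.piMass fun _ => isMass_src2 p i
  have hQ := isMass_quantBook W p (S := S) (B := B) (n := n)
  have hR : IsMass (piMass fun _ : Fin S => piMass fun _ : Fin m => relayMass p) :=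
    IsMass.piMass fun _ => IsMass.piMass fun _ => isMass_relay p
  set H : (∀ i, Fin (M i)) → (∀ i, Fin (M i) → Fin n → X₁ i) × (Fin S × Fin B → Fin n → Q) ×
      (∀ i, Fin (M i) → Fin m → X₂ i) × (Fin S → Fin m → XR) → ℝ := fun w a =>
    expect (piMass fun t => slot1Mass W (fun i => a.1 i (w i) t)) fun y =>
      expect (select (RelayTyp W p ε' (fun t => (y t).1)) a.2.1) fun u =>
        expect (piMass fun t => slot2Mass W (fun i => a.2.2.1 i (w i) t) (a.2.2.2 u.1 t)) fun z =>
          badness W p ε' ε w (a.1, a.2.1, y, u) (a.2.2.1, a.2.2.2, z) with hH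
  have hbooks := hC.bind fun _ => hQ.bind fun _ => hD.bind fun _ => hR
  have hw : ∀ w, expect (bind (bookMass M fun i => piMass fun _ : Fin n => src1Mass p i)
      fun _ => bind (piMass fun _ : Fin S × Fin B => piMass fun _ : Fin n =>
        law (joint1 W p) (fun ω => ω.2.2)) fun _ =>
      bind (bookMass M fun i => piMass fun _ : Fin m => src2Mass p i) fun _ =>
        piMass fun _ : Fin S => piMass fun _ : Fin m => relayMass p) (H w) ≤
      errorBound W p ε' ε M S B n m := by
    intro w
    refine le_trans (le_of_eq ?_) (expect_badness_le W p ε' ε (S := S) (B := B) hε' hε hn hm w)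
    simp only [ensemble, ensemble1, ensemble2, expect_bind, hH]
    congr 1
    funext c
    congr 1
    funext q
    exact (expect_comm_bind _ _ _ _ _).symm
  have havg := expect_le_const hU hw
  rw [expect_comm] at havg
  obtain ⟨⟨c, q, d, r⟩, -, hbest⟩ := exists_le_expect hbooks (fun a => expect U fun w => H w a)
  replace hbest := hbest.trans havg
  -- The cost of choosing `u` at output `y` is averaged over the messages, since the relay knows
  -- neither the messages nor the outputs at the destinations.
  obtain ⟨pick, hpick, hle⟩ := exists_pick (fun (y : Fin n → YR × ∀ k, Y₁ k) t => (y t).1)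
    (fun ρ => isMass_select (RelayTyp W p ε' ρ) q)
    (fun y u => ∑ w, U w * (piMass (fun t => slot1Mass W (fun i => c i (w i) t)) y *
      expect (piMass fun t => slot2Mass W (fun i => d i (w i) t) (r u.1 t)) fun z =>
        badness W p ε' ε w (c, q, y, u) (d, r, z)))
  let C : CFCode W p ε' M S B n m :=
    { src1 := c
      src2 := d
      quantWord := q
      relayWord := r
      pick := pick
      pick_typical := fun ρ h => of_select_pos (hpick ρ) h }
  refine ⟨C, le_trans ?_ (le_trans hle (le_trans (le_of_eq ?_) hbest))⟩
  · rw [Finset.sum_comm]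
    simp only [← Finset.mul_sum, hUdef]
    rw [Code.errorProb]
    refine mul_le_mul_of_nonneg_left ?_ (by positivity)
    refine Finset.sum_le_sum fun w _ => Finset.sum_le_sum fun y _ => ?_
    rw [expect, Finset.mul_sum]
    refine Finset.sum_le_sum fun z _ => ?_
    rw [← mul_assoc]
    refine mul_le_mul_of_nonneg_left ?_ (mul_nonneg ?_ ?_)
    · refine le_trans (le_of_eq ?_) (ind_error_le_badness ε C w y z)
      unfold ind
      split_ifs <;> rfl
    · exact Finset.prod_nonneg fun _ _ => ENNReal.toReal_nonneg
    · exact Finset.prod_nonneg fun _ _ => ENNReal.toReal_nonneg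
  · simp only [expect_sum, expect_mul_left]
    rw [Finset.sum_comm, expect]
    refine Finset.sum_congr rfl fun w _ => ?_
    rw [← Finset.mul_sum]
    rfl

end

end

end HDcMACr

namespace HDcMACr

noncomputable section

/-! ### Asymptotics -/

section slots

variable {β : ℝ}

lemma abs_slotLen_sub_le (hβ₀ : 0 < β) (l : ℕ) : |(slotLen β l : ℝ) - β * l| ≤ 1 := by
  have h0 : 0 ≤ β * l := by positivity
  have h1 := Nat.floor_le h0
  have h2 := Nat.lt_floor_add_one (β * l)
  rw [slotLen, abs_le]
  constructor <;> linarith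

lemma cast_sub_slotLen (hβ₀ : 0 < β) (hβ₁ : β < 1) (l : ℕ) :
    ((l - slotLen β l : ℕ) : ℝ) = l - slotLen β l := by
  refine Nat.cast_sub ?_
  have h1 := Nat.floor_le (by positivity : 0 ≤ β * l)
  have h2 : β * l ≤ l := mul_le_of_le_one_left (Nat.cast_nonneg l) hβ₁.le
  exact_mod_cast h1.trans h2

lemma abs_sub_slotLen_sub_le (hβ₀ : 0 < β) (hβ₁ : β < 1) (l : ℕ) :
    |((l - slotLen β l : ℕ) : ℝ) - (1 - β) * l| ≤ 1 := by
  rw [cast_sub_slotLen hβ₀ hβ₁, ← abs_neg]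
  convert abs_slotLen_sub_le hβ₀ l using 2
  ring

lemma tendsto_of_abs_sub_le {u : ℕ → ℝ} {b : ℝ} (hb : 0 < b) (h : ∀ l : ℕ, |u l - b * l| ≤ 1) :
    Tendsto u atTop atTop := by
  have h1 : Tendsto (fun l : ℕ => b * (l : ℝ) - 1) atTop atTop :=
    tendsto_atTop_add_const_right _ _ (tendsto_natCast_atTop_atTop.const_mul_atTop hb)
  refine tendsto_atTop_mono (fun l => ?_) h1
  have := (abs_le.1 (h l)).1
  linarith

lemma tendsto_slotLen (hβ₀ : 0 < β) : Tendsto (fun l => (slotLen β l : ℝ)) atTop atTop :=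
  tendsto_of_abs_sub_le hβ₀ (abs_slotLen_sub_le hβ₀)

lemma tendsto_sub_slotLen (hβ₀ : 0 < β) (hβ₁ : β < 1) :
    Tendsto (fun l => ((l - slotLen β l : ℕ) : ℝ)) atTop atTop :=
  tendsto_of_abs_sub_le (sub_pos.2 hβ₁) (abs_sub_slotLen_sub_le hβ₀ hβ₁)

/-- Rounding moves each slot length by at most 1, so the exponent changes by a constant and
probabilities by a bounded factor. -/
lemma abs_exponent_sub_le (hβ₀ : 0 < β) (hβ₁ : β < 1) (a b : ℝ) (l : ℕ) :
    |(slotLen β l * a + (l - slotLen β l : ℕ) * b) - l * (β * a + (1 - β) * b)| ≤ |a| + |b| := by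
  have e : (slotLen β l * a + (l - slotLen β l : ℕ) * b) - l * (β * a + (1 - β) * b) =
      (slotLen β l - β * l) * a + ((l - slotLen β l : ℕ) - (1 - β) * l) * b := by ring
  rw [e]
  refine (abs_add_le _ _).trans (add_le_add ?_ ?_)
  · rw [abs_mul]
    exact mul_le_of_le_one_left (abs_nonneg _) (abs_slotLen_sub_le hβ₀ l)
  · rw [abs_mul]
    exact mul_le_of_le_one_left (abs_nonneg _) (abs_sub_slotLen_sub_le hβ₀ hβ₁ l)

lemma tendsto_two_rpow_mul {c : ℝ} (hc : c < 0) :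
    Tendsto (fun l : ℕ => (2 : ℝ) ^ ((l : ℝ) * c)) atTop (𝓝 0) := by
  have h : ∀ l : ℕ, (2 : ℝ) ^ ((l : ℝ) * c) = ((2 : ℝ) ^ c) ^ l := fun l => by
    rw [mul_comm, Real.rpow_mul zero_le_two, Real.rpow_natCast]
  simp only [h]
  exact tendsto_pow_atTop_nhds_zero_of_lt_one (by positivity)
    (Real.rpow_lt_one_of_one_lt_of_neg one_lt_two hc)

/-- `2 ^ (l r)` candidates, each with an error probability of exponent `n a + m b`. -/
lemma tendsto_count_mul (hβ₀ : 0 < β) (hβ₁ : β < 1) {N : ℕ → ℝ} {r a b : ℝ} (hN0 : ∀ l, 0 ≤ N l)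
    (hN : ∀ l : ℕ, N l ≤ (2 : ℝ) ^ ((l : ℝ) * r)) (hr : r < β * a + (1 - β) * b) :
    Tendsto (fun l => N l * ((2 : ℝ) ^ (-(slotLen β l * a)) *
      (2 : ℝ) ^ (-((l - slotLen β l : ℕ) * b)))) atTop (𝓝 0) := by
  have h1 := (tendsto_two_rpow_mul (sub_neg.2 hr)).const_mul ((2 : ℝ) ^ (|a| + |b|))
  rw [mul_zero] at h1
  refine squeeze_zero (fun l => mul_nonneg (hN0 l) (by positivity)) (fun l => ?_) h1
  refine (mul_le_mul_of_nonneg_right (hN l) (by positivity)).trans ?_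
  rw [← Real.rpow_add two_pos, ← Real.rpow_add two_pos, ← Real.rpow_add two_pos]
  refine Real.rpow_le_rpow_of_exponent_le one_le_two ?_
  have := (abs_le.1 (abs_exponent_sub_le hβ₀ hβ₁ a b l)).1
  linarith

lemma size_sub_one_le (l : ℕ) (r : ℝ) : ((size l r - 1 : ℕ) : ℝ) ≤ (2 : ℝ) ^ ((l : ℝ) * r) := by
  have h1 := Nat.ceil_lt_add_one (by positivity : 0 ≤ (2 : ℝ) ^ ((l : ℝ) * r))
  have h2 : 1 ≤ size l r := NeZero.one_le
  rw [Nat.cast_sub h2, Nat.cast_one]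
  unfold size
  linarith

lemma size_zero (l : ℕ) : size l 0 = 1 := by simp [size]

/-- At rate 0 there is exactly one candidate and so no wrong one: the count `size - 1` is 0 whatever
the exponent. This makes bin rates of 0 usable when an information vanishes. -/
lemma tendsto_size_mul (hβ₀ : 0 < β) (hβ₁ : β < 1) {r a b : ℝ}
    (hr : r = 0 ∨ r < β * a + (1 - β) * b) :
    Tendsto (fun l => ((size l r - 1 : ℕ) : ℝ) * ((2 : ℝ) ^ (-(slotLen β l * a)) *
      (2 : ℝ) ^ (-((l - slotLen β l : ℕ) * b)))) atTop (𝓝 0) := by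
  rcases hr with rfl | hr
  · simp [size_zero]
  · exact tendsto_count_mul hβ₀ hβ₁ (fun l => Nat.cast_nonneg _) (fun l => size_sub_one_le l r) hr

/-- The expected number of suitable words grows like `2 ^ (l * (r + s - β * c))`, up to the factor
`2 ^ (-|c|)` lost by rounding the slot length. -/
lemma tendsto_exp_cover (hβ₀ : 0 < β) (hβ₁ : β < 1) {r s c : ℝ} (h : β * c < r + s) :
    Tendsto (fun l => Real.exp (-((size l r * size l s : ℕ) *
      (2 : ℝ) ^ (-(slotLen β l * c)) / 2))) atTop (𝓝 0) := by
  refine Real.tendsto_exp_atBot.comp (tendsto_neg_atTop_atBot.comp ?_)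
  refine Tendsto.atTop_div_const two_pos ?_
  have h1 : Tendsto (fun l : ℕ => (2 : ℝ) ^ (-|c|) * (2 : ℝ) ^ ((l : ℝ) * (r + s - β * c)))
      atTop atTop := by
    refine Tendsto.const_mul_atTop (by positivity) ?_
    have e : ∀ l : ℕ, (2 : ℝ) ^ ((l : ℝ) * (r + s - β * c)) =
        ((2 : ℝ) ^ (r + s - β * c)) ^ l := fun l => by
      rw [mul_comm, Real.rpow_mul zero_le_two, Real.rpow_natCast]
    simp only [e]
    exact tendsto_pow_atTop_atTop_of_one_lt (Real.one_lt_rpow one_lt_two (sub_pos.2 h))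
  refine tendsto_atTop_mono (fun l => ?_) h1
  have h2 : (2 : ℝ) ^ ((l : ℝ) * r) * (2 : ℝ) ^ ((l : ℝ) * s) ≤ (size l r * size l s : ℕ) := by
    rw [Nat.cast_mul]
    exact mul_le_mul (Nat.le_ceil _) (Nat.le_ceil _) (by positivity) (Nat.cast_nonneg _)
  refine le_trans ?_ (mul_le_mul_of_nonneg_right h2 (by positivity))
  rw [← Real.rpow_add two_pos, ← Real.rpow_add two_pos, ← Real.rpow_add two_pos]
  refine Real.rpow_le_rpow_of_exponent_le one_le_two ?_
  have := (abs_le.1 (abs_exponent_sub_le hβ₀ hβ₁ c 0 l)).2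
  simp only [mul_zero, add_zero, abs_zero] at this
  linarith

end slots

/-! ### Convergence of the error bound and choice of the parameters. -/

section

variable {X₁ X₂ : Fin 2 → Type*} {XR YR Q : Type*} {Y₁ Y₂ : Fin 2 → Type*}
  [∀ i, Fintype (X₁ i)] [∀ i, Fintype (X₂ i)] [Fintype XR] [Fintype YR] [Fintype Q]
  [∀ k, Fintype (Y₁ k)] [∀ k, Fintype (Y₂ k)]
  (W : Channel X₁ X₂ XR YR Y₁ Y₂) (p : InputDist X₁ X₂ XR YR Q) {β : ℝ}

lemma tendsto_errorBoundAt (hβ₀ : 0 < β) (hβ₁ : β < 1) {ε' ε RS RB : ℝ} {R : Fin 2 → ℝ}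
    (k : Fin 2) (hS : RS = 0 ∨ RS < (1 - β) * binRate W p ε k)
    (hB : RB = 0 ∨ RB < β * quantRate W p ε k)
    (hone : ∀ i, R i < β * oneRate1 W p ε k i + (1 - β) * oneRate2 W p ε k i)
    (hboth : R 0 + R 1 < β * bothRate1 W p ε k + (1 - β) * bothRate2 W p ε k) :
    Tendsto (fun l => errorBoundAt W p ε' ε k (fun i => size l (R i)) (size l RS) (size l RB)
      (slotLen β l) (l - slotLen β l)) atTop (𝓝 0) := by
  unfold errorBoundAt
  have t1 := (tendsto_slotLen hβ₀).const_div_atTop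
    (chebConst (joint1 W p) (fun ω => ((ω.1, ω.2.1.2 k), ω.2.2)) (ε - ε'))
  have t2 := (tendsto_sub_slotLen hβ₀ hβ₁).const_div_atTop
    (chebConst (joint2 W p) (fun ω => (ω.1, ω.2.1, ω.2.2 k)) ε)
  have t3 := tendsto_size_mul hβ₀ hβ₁ (r := RS) (a := 0) (b := binRate W p ε k) (by simpa using hS)
  have t4 := (tendsto_size_mul hβ₀ hβ₁ (r := RB) (a := quantRate W p ε k) (b := 0)
    (by simpa using hB)).const_mul 2
  simp only [mul_zero, neg_zero, Real.rpow_zero, one_mul, mul_one] at t3 t4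
  have t5 : Tendsto (fun l => ∑ i, ((size l (R i) - 1 : ℕ) : ℝ) *
      ((2 : ℝ) ^ (-(slotLen β l * oneRate1 W p ε k i)) *
        (2 : ℝ) ^ (-((l - slotLen β l : ℕ) * oneRate2 W p ε k i)))) atTop (𝓝 (∑ i : Fin 2, 0)) :=
    tendsto_finsetSum _ fun i _ => tendsto_size_mul hβ₀ hβ₁ (Or.inr (hone i))
  have t6 := tendsto_count_mul hβ₀ hβ₁ (N := fun l => (∏ i, (size l (R i) - 1) : ℕ))
    (r := R 0 + R 1) (a := bothRate1 W p ε k) (b := bothRate2 W p ε k)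
    (fun l => Nat.cast_nonneg _) (fun l => ?_) hboth
  · simpa using ((((t1.add t2).add t3).add t4).add (t5.add t6))
  · rw [Fin.prod_univ_two, Nat.cast_mul, mul_add, Real.rpow_add two_pos]
    exact mul_le_mul (size_sub_one_le _ _) (size_sub_one_le _ _) (Nat.cast_nonneg _)
      (by positivity)

lemma tendsto_errorBound (hβ₀ : 0 < β) (hβ₁ : β < 1) {ε' ε RS RB : ℝ} {R : Fin 2 → ℝ}
    (hU : β * coverRate W p ε' < RS + RB)
    (hS : ∀ k, RS = 0 ∨ RS < (1 - β) * binRate W p ε k)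
    (hB : ∀ k, RB = 0 ∨ RB < β * quantRate W p ε k)
    (hone : ∀ k i, R i < β * oneRate1 W p ε k i + (1 - β) * oneRate2 W p ε k i)
    (hboth : ∀ k, R 0 + R 1 < β * bothRate1 W p ε k + (1 - β) * bothRate2 W p ε k) :
    Tendsto (fun l => errorBound W p ε' ε (fun i => size l (R i)) (size l RS) (size l RB)
      (slotLen β l) (l - slotLen β l)) atTop (𝓝 0) := by
  unfold errorBound
  have t1 := ((tendsto_slotLen hβ₀).const_div_atTop
    (chebConst (joint1 W p) (fun ω => (ω.2.1.1, ω.2.2)) ε')).const_mul 2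
  have t2 := tendsto_exp_cover hβ₀ hβ₁ hU
  have t3 := tendsto_finsetSum Finset.univ fun k _ =>
    tendsto_errorBoundAt W p hβ₀ hβ₁ (ε' := ε') k (hS k) (hB k) (hone k) (hboth k)
  simpa using (t1.add t2).add t3

variable {W p}

lemma Code.errorProb_nonneg {M : Fin 2 → ℕ} {n m : ℕ} (C : Code X₁ X₂ XR YR Y₁ Y₂ M n m)
    (W : Channel X₁ X₂ XR YR Y₁ Y₂) : 0 ≤ C.errorProb W := by
  refine mul_nonneg (by positivity) (Finset.sum_nonneg fun w _ => Finset.sum_nonneg fun y _ =>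
    Finset.sum_nonneg fun z _ => mul_nonneg (mul_nonneg ?_ ?_) ?_)
  · exact Finset.prod_nonneg fun _ _ => ENNReal.toReal_nonneg
  · exact Finset.prod_nonneg fun _ _ => ENNReal.toReal_nonneg
  · split_ifs <;> norm_num

variable (W p)

/-- Serves the short blocks in which a slot is empty and the error bound is unavailable. The
alphabets have elements because mass functions live on them, and with constant words every index is
as suitable as any other. -/
lemma nonempty_cfCode (ε' : ℝ) (M : Fin 2 → ℕ) (S B n m : ℕ) [NeZero S] [NeZero B] :
    Nonempty (CFCode W p ε' M S B n m) := by
  classical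
  obtain ⟨ω₁, -⟩ := exists_le_expect (isMass_joint1 W p) 0
  obtain ⟨ω₂, -⟩ := exists_le_expect (isMass_joint2 W p) 0
  exact ⟨
    { src1 := fun i _ _ => ω₁.1 i
      src2 := fun i _ _ => ω₂.1 i
      quantWord := fun _ _ => ω₁.2.2
      relayWord := fun _ _ => ω₂.2.1
      pick := fun _ => 0
      pick_typical := fun _ h => h.choose_spec }⟩

lemma achievableByCF_of_rates (hβ₀ : 0 < β) (hβ₁ : β < 1) {ε' ε RS RU : ℝ} {R : Fin 2 → ℝ}
    (hε' : 0 < ε') (hεε : ε' < ε) (hε : ε < 1) (hRS : 0 ≤ RS) (hRU : RS ≤ RU)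
    (hU : β * coverRate W p ε' < RU)
    (hS : ∀ k, RS = 0 ∨ RS < (1 - β) * binRate W p ε k)
    (hB : ∀ k, RU - RS = 0 ∨ RU - RS < β * quantRate W p ε k)
    (hone : ∀ k i, R i < β * oneRate1 W p ε k i + (1 - β) * oneRate2 W p ε k i)
    (hboth : ∀ k, R 0 + R 1 < β * bothRate1 W p ε k + (1 - β) * bothRate2 W p ε k) :
    AchievableByCF W p β R := by
  have hC : ∀ l : ℕ, ∃ C : CFCode W p ε' (fun i => size l (R i)) (size l RS) (size l (RU - RS))
      (slotLen β l) (l - slotLen β l), 0 < slotLen β l → 0 < l - slotLen β l →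
      (C.toCode ε).errorProb W ≤ errorBound W p ε' ε (fun i => size l (R i)) (size l RS)
        (size l (RU - RS)) (slotLen β l) (l - slotLen β l) := by
    intro l
    by_cases h : 0 < slotLen β l ∧ 0 < l - slotLen β l
    · obtain ⟨C, hC⟩ := exists_code_errorProb_le W p ε' ε (M := fun i => size l (R i))
        (S := size l RS) (B := size l (RU - RS)) hε' hεε h.1 h.2
      exact ⟨C, fun _ _ => hC⟩
    · obtain ⟨C⟩ := nonempty_cfCode W p ε' (fun i => size l (R i)) (size l RS) (size l (RU - RS))
        (slotLen β l) (l - slotLen β l)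
      exact ⟨C, fun h1 h2 => absurd ⟨h1, h2⟩ h⟩
  choose C hC using hC
  refine ⟨ε', ε, RS, RU, hε', hεε, hε, hRS, hRU, C, ?_⟩
  refine squeeze_zero' (Eventually.of_forall fun l => Code.errorProb_nonneg _ W) ?_
    (tendsto_errorBound W p hβ₀ hβ₁ (by rwa [add_sub_cancel]) hS hB hone hboth)
  filter_upwards [(tendsto_slotLen hβ₀).eventually_gt_atTop 0,
    (tendsto_sub_slotLen hβ₀ hβ₁).eventually_gt_atTop 0] with l h1 h2
  exact hC l (by exact_mod_cast h1) (by exact_mod_cast h2)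

/-- Each of the two minima is lowered by a quarter of the slack `V + D - c`, so half the slack
remains for the sum. Truncation at 0 covers a minimum smaller than that; it only increases the sum,
and a zero rate is exempt from its upper bound. -/
lemma exists_bin_rates {c : ℝ} {v d : Fin 2 → ℝ} (h : ∀ j k, c < v j + d k) :
    ∃ RS RB : ℝ, 0 ≤ RS ∧ 0 ≤ RB ∧ c < RS + RB ∧ (∀ k, RS = 0 ∨ RS < d k) ∧
      (∀ k, RB = 0 ∨ RB < v k) := by
  set D := min (d 0) (d 1) with hD
  set V := min (v 0) (v 1) with hV
  have hc : c < V + D := by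
    rcases min_choice (d 0) (d 1) with h1 | h1 <;> rcases min_choice (v 0) (v 1) with h2 | h2 <;>
      · rw [hD, hV, h1, h2]; exact h _ _
  have hd : ∀ k, D ≤ d k := Fin.forall_fin_two.2 ⟨min_le_left _ _, min_le_right _ _⟩
  have hv : ∀ k, V ≤ v k := Fin.forall_fin_two.2 ⟨min_le_left _ _, min_le_right _ _⟩
  have hmax : ∀ {x η y : ℝ}, 0 < η → x ≤ y → max (x - η) 0 = 0 ∨ max (x - η) 0 < y := by
    intro x η y hη hxy
    rcases le_total (x - η) 0 with h1 | h1
    · exact Or.inl (max_eq_right h1)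
    · exact Or.inr (by rw [max_eq_left h1]; linarith)
  have hη : 0 < (V + D - c) / 4 := by linarith
  refine ⟨max (D - (V + D - c) / 4) 0, max (V - (V + D - c) / 4) 0, le_max_right _ _,
    le_max_right _ _, ?_, fun k => hmax hη (hd k), fun k => hmax hη (hv k)⟩
  have h1 := le_max_left (D - (V + D - c) / 4) 0
  have h2 := le_max_left (V - (V + D - c) / 4) 0
  linarith

lemma eventually_lt_of_continuous {f : ℝ → ℝ} (hf : Continuous f) {r : ℝ} (h : r < f 0) :
    ∀ᶠ ε in 𝓝[>] (0 : ℝ), r < f ε :=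
  (hf.continuousAt.eventually_const_lt h).filter_mono nhdsWithin_le_nhds

/-- At `ε = 0` the exponents are the informations themselves, and they are affine in `ε`. So the
finitely many strict inequalities hold together for some small `ε > 0`. -/
lemma achievableByCF_of_info (hβ₀ : 0 < β) (hβ₁ : β < 1) {R : Fin 2 → ℝ}
    (hcond : ∀ j k, β * (infoRelayQuant W p - infoDestQuant W p j) <
      (1 - β) * infoRelayDest W p k)
    (hR : ∀ k i, R i < aBound W p β k i) (hsum : ∀ k, R 0 + R 1 < cBound W p β k) :
    AchievableByCF W p β R := by
  obtain ⟨RS, RB, hRS, hRB, hc, hS, hB⟩ := exists_bin_rates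
    (c := β * infoRelayQuant W p) (v := fun k => β * infoDestQuant W p k)
    (d := fun k => (1 - β) * infoRelayDest W p k) (fun j k => by linarith [hcond j k])
  have e0 : ∀ᶠ ε in 𝓝[>] (0 : ℝ), 0 < ε ∧ ε < 1 := Ioo_mem_nhdsGT one_pos
  -- Covering is tested at the relay's parameter `ε' = ε / 2`. Both sides are negated because the
  -- quantity depending on `ε` must be the larger one.
  have e1 : ∀ᶠ ε in 𝓝[>] (0 : ℝ), -(RS + RB) < -(β * coverRate W p (ε / 2)) :=
    eventually_lt_of_continuous (by unfold coverRate; fun_prop) (by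
      simpa [coverRate] using hc)
  have e2 : ∀ᶠ ε in 𝓝[>] (0 : ℝ), ∀ k, RS = 0 ∨ RS < (1 - β) * binRate W p ε k := by
    refine eventually_all.2 fun k => ?_
    rcases hS k with h | h
    · exact Eventually.of_forall fun _ => Or.inl h
    · refine (eventually_lt_of_continuous (f := fun ε => (1 - β) * binRate W p ε k)
        (by unfold binRate packRate; fun_prop) ?_).mono fun _ => Or.inr
      simpa [binRate, packRate, infoRelayDest] using h
  have e3 : ∀ᶠ ε in 𝓝[>] (0 : ℝ), ∀ k, RB = 0 ∨ RB < β * quantRate W p ε k := by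
    refine eventually_all.2 fun k => ?_
    rcases hB k with h | h
    · exact Eventually.of_forall fun _ => Or.inl h
    · refine (eventually_lt_of_continuous (f := fun ε => β * quantRate W p ε k)
        (by unfold quantRate packRate; fun_prop) ?_).mono fun _ => Or.inr
      rw [infoDestQuant, mutualInfo_comm] at h
      simpa [quantRate, packRate] using h
  have e4 : ∀ᶠ ε in 𝓝[>] (0 : ℝ), ∀ k i,
      R i < β * oneRate1 W p ε k i + (1 - β) * oneRate2 W p ε k i := by
    refine eventually_all.2 fun k => eventually_all.2 fun i => ?_
    refine eventually_lt_of_continuous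
      (f := fun ε => β * oneRate1 W p ε k i + (1 - β) * oneRate2 W p ε k i)
      (by unfold oneRate1 oneRate2 packRate; fun_prop) ?_
    simpa [oneRate1, oneRate2, packRate, aBound] using hR k i
  have e5 : ∀ᶠ ε in 𝓝[>] (0 : ℝ), ∀ k,
      R 0 + R 1 < β * bothRate1 W p ε k + (1 - β) * bothRate2 W p ε k := by
    refine eventually_all.2 fun k => ?_
    refine eventually_lt_of_continuous
      (f := fun ε => β * bothRate1 W p ε k + (1 - β) * bothRate2 W p ε k)
      (by unfold bothRate1 bothRate2 packRate; fun_prop) ?_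
    simpa [bothRate1, bothRate2, packRate, cBound] using hsum k
  obtain ⟨ε, ⟨h0, h01⟩, h1, h2, h3, h4, h5⟩ :=
    (e0.and (e1.and (e2.and (e3.and (e4.and e5))))).exists
  refine achievableByCF_of_rates W p hβ₀ hβ₁ (ε' := ε / 2) (ε := ε) (RS := RS) (RU := RS + RB)
    (by linarith) (by linarith) h01 hRS (by linarith) (neg_lt_neg_iff.1 h1) h2 ?_ h4 h5
  rwa [add_sub_cancel_left]

lemma AchievableByCF.achievable {W : Channel X₁ X₂ XR YR Y₁ Y₂} {p : InputDist X₁ X₂ XR YR Q}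
    {R : Fin 2 → ℝ} (h : AchievableByCF W p β R) : Achievable W β R := by
  obtain ⟨ε', ε, RS, RU, -, -, -, -, -, C, hC⟩ := h
  exact ⟨fun l => (C l).toCode ε, hC⟩

end

end

end HDcMACr

theorem theorem4 {X₁ X₂ : Fin 2 → Type*} {XR YR Q : Type*} {Y₁ Y₂ : Fin 2 → Type*}
    [∀ i, Fintype (X₁ i)] [∀ i, Fintype (X₂ i)] [Fintype XR] [Fintype YR] [Fintype Q]
    [∀ k, Fintype (Y₁ k)] [∀ k, Fintype (Y₂ k)]
    (W : HDcMACr.Channel X₁ X₂ XR YR Y₁ Y₂) (p : HDcMACr.InputDist X₁ X₂ XR YR Q)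
    (β : ℝ) (hβ₀ : 0 < β) (hβ₁ : β < 1)
    (hcond :
      max (β * (HDcMACr.infoRelayQuant W p - HDcMACr.infoDestQuant W p 0))
          (β * (HDcMACr.infoRelayQuant W p - HDcMACr.infoDestQuant W p 1)) <
      min ((1 - β) * HDcMACr.infoRelayDest W p 0) ((1 - β) * HDcMACr.infoRelayDest W p 1))
    (R : Fin 2 → ℝ)
    (hR : ∀ i, R i < min (HDcMACr.aBound W p β 0 i) (HDcMACr.aBound W p β 1 i))
    (hsum : R 0 + R 1 < min (HDcMACr.cBound W p β 0) (HDcMACr.cBound W p β 1)) :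
    HDcMACr.Achievable W β R ∧ HDcMACr.AchievableByCF W p β R := by
  have h : HDcMACr.AchievableByCF W p β R := by
    refine HDcMACr.achievableByCF_of_info W p hβ₀ hβ₁ ?_ ?_ ?_
    · simp only [max_lt_iff, lt_min_iff] at hcond
      simp only [Fin.forall_fin_two]
      tauto
    · exact Fin.forall_fin_two.2
        ⟨fun i => (lt_min_iff.1 (hR i)).1, fun i => (lt_min_iff.1 (hR i)).2⟩
    · exact Fin.forall_fin_two.2 (lt_min_iff.1 hsum)
  exact ⟨h.achievable, h⟩
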